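/- Let $\mathfrak n=\mathfrak n_0\oplus\mathfrak n_1$ be a finite-dimensional real Lie superalgebra that is nilpotent, i.e. for some $k$ it is $k$-step nilpotent: any $k$ nested brackets $[x_1,[x_2,\dots,[x_k,y]\dots]]$ vanish. For a Grassmann algebra $A=\Lambda\mathbb R^p=A_0\oplus A_1$ put $\mathfrak n_A=(A\otimes\mathfrak n)_0=A_0\otimes\mathfrak n_0\oplus A_1\otimes\mathfrak n_1$, with the bracket $[a\otimes x,b\otimes y]_A=(-1)^{|x||b|}ab\otimes[x,y]$, which makes it a Lie algebra over the commutative ring $A_0$. The supermanifold $\mathfrak n$ is the functor $A\mapsto \mathfrak n_A$ on Grassmann algebras and parity-preserving algebra homomorphisms; a smooth map between the supermanifolds of two super vector spaces is a natural transformation whose components are $A_0$-smooth, that is, smooth with $A_0$-linear derivative at every point. A supergroup is a group object in supermanifolds. Then: 1. For every Grassmann algebra $A$, the Lie algebra $\mathfrak n_A$ is nilpotent. 2. If $\mathfrak n$ is $k$-step nilpotent, then for every $A$ and all $X,Y\in\mathfrak n_A$ all terms of degree $>k$ of the Baker--Campbell--Hausdorff series $$Z(X,Y)=\sum_{d\ge1}\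 \sum_{m=1}^{d}\frac{(-1)^{m-1}}{m\,d}\sum_{\substack{r_i+s_i>0\ (1\le i\le m)\\ \sum_i(r_i+s_i)=d}}\frac{[X^{r_1}Y^{s_1}\cdots X^{r_m}Y^{s_m}]}{r_1!s_1!\cdots r_m!s_m!}=X+Y+\tfrac12[X,Y]_A+\cdots$$ vanish, where $[\cdots]$ is the right-nested bracket of a word; so the series terminates. 3. There is a supergroup $N$ on the supermanifold $\mathfrak n$, i.e. there are smooth maps of supermanifolds (natural in $A$ and $A_0$-smooth) $m:N\times N\to N$, $\mathrm{inv}:N\to N$ and $\mathrm{id}:1\to N$ satisfying the group axioms, given on $A$-points, for every $A$ and all $X,Y\in \mathfrak n_A=N_A$, by $$m_A(X,Y)=Z(X,Y),\qquad \mathrm{inv}_A(X)=-X,\qquad \mathrm{id}_A(1)=0.$$ -/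

import Mathlib

open CategoryTheory MonoidalCategory
open scoped TensorProduct ContDiff

universe u

/-! ### Grassmann algebras -/

/-- The Grassmann algebra `A = Λ ℝᵖ`. -/
abbrev Grassmann (p : ℕ) : Type := ExteriorAlgebra ℝ (Fin p → ℝ)

namespace Grassmann

/-- The parity grading of `A = Λ ℝᵖ`: `part p 0` is the sum of the even exterior powers,
`part p 1` the sum of the odd ones. -/
abbrev part (p : ℕ) (i : ZMod 2) : Submodule ℝ (Grassmann p) :=
  CliffordAlgebra.evenOdd (0 : QuadraticForm ℝ (Fin p → ℝ)) i

/-- The even part `A₀` of `A = Λ ℝᵖ`, as an algebra. -/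
abbrev evenPart (p : ℕ) : Subalgebra ℝ (Grassmann p) :=
  CliffordAlgebra.even (0 : QuadraticForm ℝ (Fin p → ℝ))

instance (p : ℕ) : Module.Finite ℝ (Grassmann p) :=
  Module.Finite.of_basis (Pi.basisFun ℝ (Fin p)).ExteriorAlgebra

end Grassmann

/-- The sign `(-1)^(ij)` of the rule of signs. -/
def superSign (i j : ZMod 2) : ℝ := (-1) ^ (i.val * j.val)

theorem superSign_mul_self (i j : ZMod 2) : superSign i j * superSign i j = 1 := by
  unfold superSign
  rw [← mul_pow]
  norm_num

theorem superSign_comm (i j : ZMod 2) : superSign i j = superSign j i := by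
  unfold superSign
  rw [mul_comm]

theorem Grassmann.mul_comm_sign {p : ℕ} {i j : ZMod 2} {a b : Grassmann p}
    (ha : a ∈ part p i) (hb : b ∈ part p j) : a * b = superSign i j • (b * a) := by
  have h := CliffordAlgebra.map_mul_map_of_isOrtho_of_mem_evenOdd
    (QuadraticMap.Isometry.id (0 : QuadraticForm ℝ (Fin p → ℝ)))
    (QuadraticMap.Isometry.id (0 : QuadraticForm ℝ (Fin p → ℝ)))
    (by intro x y; simp [QuadraticMap.isOrtho_def]) a b ha hb
  simp only [CliffordAlgebra.map_id, AlgHom.coe_id, id_eq] at h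
  rw [h]
  clear h ha hb
  revert i j
  have aux : ∀ i : ZMod 2, i = 0 ∨ i = 1 := by decide
  intro i j
  rcases aux i with rfl | rfl <;> rcases aux j with rfl | rfl <;>
    simp [superSign, ZMod.val_one]

instance (p : ℕ) : CommRing (Grassmann.evenPart p) :=
  { (inferInstance : Ring (Grassmann.evenPart p)) with
    mul_comm := fun a b => by
      apply Subtype.ext
      have h := Grassmann.mul_comm_sign (p := p) (i := 0) (j := 0) a.2 b.2
      simpa [superSign] using h }

/-- Homomorphisms of Grassmann algebras: algebra homomorphisms that preserve the parity grading. -/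
structure GrassmannHom (p q : ℕ) where
  toAlgHom : Grassmann p →ₐ[ℝ] Grassmann q
  map_part : ∀ (i : ZMod 2) (a : Grassmann p),
    a ∈ Grassmann.part p i → toAlgHom a ∈ Grassmann.part q i

/-! ### Super vector spaces and their `A`-points -/

/-- A finite-dimensional real super vector space `V = V₀ ⊕ V₁`. -/
structure SuperVect : Type (u + 1) where
  carrier : Type u
  [addCommGroup : AddCommGroup carrier]
  [module : Module ℝ carrier]
  [finite : FiniteDimensional ℝ carrier]
  grade : ZMod 2 → Submodule ℝ carrier
  isCompl : IsCompl (grade 0) (grade 1)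

namespace SuperVect

attribute [instance] SuperVect.addCommGroup SuperVect.module SuperVect.finite

/-- The even part `(A ⊗ V)₀ = A₀ ⊗ V₀ ⊕ A₁ ⊗ V₁` of `A ⊗ V`, as an `A₀`-submodule: the real span of
the tensors `a ⊗ x` with `a` and `x` homogeneous of the same parity. -/
def evenTensor (V : SuperVect.{u}) (p : ℕ) :
    Submodule (Grassmann.evenPart p) (Grassmann p ⊗[ℝ] V.carrier) :=
  { Submodule.span ℝ {t : Grassmann p ⊗[ℝ] V.carrier |
      ∃ i : ZMod 2, ∃ a ∈ Grassmann.part p i, ∃ x ∈ V.grade i, a ⊗ₜ[ℝ] x = t} with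
    smul_mem' := by
      intro c t ht
      induction ht using Submodule.span_induction with
      | mem t ht =>
        obtain ⟨i, a, ha, x, hx, rfl⟩ := ht
        refine Submodule.subset_span ⟨i, (c : Grassmann p) * a, ?_, x, hx, ?_⟩
        · have := CliffordAlgebra.evenOdd_mul_le (0 : QuadraticForm ℝ (Fin p → ℝ)) 0 i
            (Submodule.mul_mem_mul c.2 ha)
          simpa using this
        · rfl
      | zero => rw [smul_zero]; exact Submodule.zero_mem _
      | add s t _ _ hs ht => rw [smul_add]; exact Submodule.add_mem _ hs ht
      | smul r t _ ht => rw [smul_comm]; exact Submodule.smul_mem _ r ht }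

/-- The `A`-points `V_A = (A ⊗ V)₀` of the supermanifold `V`, for `A = Λ ℝᵖ`. -/
def Points (V : SuperVect.{u}) (p : ℕ) : Type u := V.evenTensor p

variable {U V W : SuperVect.{u}} {p q : ℕ}

noncomputable instance : AddCommGroup (V.Points p) :=
  inferInstanceAs (AddCommGroup (V.evenTensor p))

noncomputable instance : Module (Grassmann.evenPart p) (V.Points p) :=
  inferInstanceAs (Module (Grassmann.evenPart p) (V.evenTensor p))

noncomputable instance : Module ℝ (V.Points p) :=
  inferInstanceAs (Module ℝ (V.evenTensor p))

instance : IsScalarTower ℝ (Grassmann.evenPart p) (V.Points p) :=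
  inferInstanceAs (IsScalarTower ℝ (Grassmann.evenPart p) (V.evenTensor p))

instance : FiniteDimensional ℝ (V.Points p) :=
  inferInstanceAs (FiniteDimensional ℝ ((V.evenTensor p).restrictScalars ℝ))

/-- `V_A` as a normed space, with the sup norm in some linear coordinates. Since `V_A` is
finite-dimensional, its topology and the notions of smooth map and derivative do not depend on the
choice of coordinates. -/
noncomputable instance : NormedAddCommGroup (V.Points p) :=
  NormedAddCommGroup.induced (V.Points p) (Fin (Module.finrank ℝ (V.Points p)) → ℝ)
    (Module.finBasis ℝ (V.Points p)).equivFun (LinearEquiv.injective _)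

noncomputable instance : NormedSpace ℝ (V.Points p) :=
  NormedSpace.induced ℝ (V.Points p) (Fin (Module.finrank ℝ (V.Points p)) → ℝ)
    (Module.finBasis ℝ (V.Points p)).equivFun

theorem tmul_mem_evenTensor {i : ZMod 2} {a : Grassmann p} (ha : a ∈ Grassmann.part p i)
    {x : V.carrier} (hx : x ∈ V.grade i) : a ⊗ₜ[ℝ] x ∈ V.evenTensor p :=
  Submodule.subset_span ⟨i, a, ha, x, hx, rfl⟩

/-- The `A`-point `a ⊗ x` of `V`, for `a` and `x` homogeneous of the same parity. -/
def tmul {i : ZMod 2} {a : Grassmann p} (ha : a ∈ Grassmann.part p i)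
    {x : V.carrier} (hx : x ∈ V.grade i) : V.Points p :=
  ⟨a ⊗ₜ[ℝ] x, tmul_mem_evenTensor ha hx⟩

theorem Points.induction {motive : V.Points p → Prop}
    (tmul : ∀ (i : ZMod 2) (a : Grassmann p) (ha : a ∈ Grassmann.part p i) (x : V.carrier)
      (hx : x ∈ V.grade i), motive (tmul ha hx))
    (zero : motive 0)
    (add : ∀ s t, motive s → motive t → motive (s + t))
    (smul : ∀ (r : ℝ) t, motive t → motive (r • t)) (t : V.Points p) : motive t := by
  obtain ⟨t, ht⟩ := t
  change t ∈ Submodule.span ℝ _ at ht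
  induction ht using Submodule.span_induction with
  | mem t ht =>
    obtain ⟨i, a, ha, x, hx, rfl⟩ := ht
    exact tmul i a ha x hx
  | zero => exact zero
  | add s t hs ht h₁ h₂ => exact add ⟨s, hs⟩ ⟨t, ht⟩ h₁ h₂
  | smul r t ht h₁ => exact smul r ⟨t, ht⟩ h₁

theorem rTensor_mem (f : GrassmannHom p q) (t : V.Points p) :
    LinearMap.rTensor V.carrier f.toAlgHom.toLinearMap t.1 ∈ V.evenTensor q := by
  induction t using Points.induction with
  | tmul i a ha x hx => exact tmul_mem_evenTensor (f.map_part i a ha) hx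
  | zero => exact (map_zero (LinearMap.rTensor V.carrier f.toAlgHom.toLinearMap)) ▸
      Submodule.zero_mem _
  | add s t hs ht =>
    have : (s + t).1 = s.1 + t.1 := rfl
    rw [this, map_add]
    exact Submodule.add_mem _ hs ht
  | smul r t ht =>
    have : (r • t).1 = r • t.1 := rfl
    rw [this, map_smul]
    exact Submodule.smul_mem ((V.evenTensor q).restrictScalars ℝ) r ht

/-- The linear map `V_f = (f ⊗ 1)₀ : V_A → V_B` induced by `f : A → B`. -/
noncomputable def map (V : SuperVect.{u}) (f : GrassmannHom p q) : V.Points p →ₗ[ℝ] V.Points q where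
  toFun t := ⟨LinearMap.rTensor V.carrier f.toAlgHom.toLinearMap t.1, rTensor_mem f t⟩
  map_add' s t := Subtype.ext (map_add (LinearMap.rTensor V.carrier f.toAlgHom.toLinearMap) s.1 t.1)
  map_smul' r t :=
    Subtype.ext (map_smul (LinearMap.rTensor V.carrier f.toAlgHom.toLinearMap) r t.1)

/-! ### The category of supermanifolds associated to super vector spaces -/

/-- A map `V_A → W_A` is `A₀`-smooth if it is smooth and its derivative at every point is
`A₀`-linear. -/
def IsEvenSmooth (φ : V.Points p → W.Points p) : Prop :=
  ContDiff ℝ ∞ φ ∧ ∀ (x : V.Points p) (c : Grassmann.evenPart p) (v : V.Points p),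
    fderiv ℝ φ x (c • v) = c • fderiv ℝ φ x v

/-- A smooth map `V → W` of supermanifolds: a natural transformation with `A₀`-smooth
components. -/
@[ext]
structure Hom (V W : SuperVect.{u}) where
  app : ∀ p : ℕ, V.Points p → W.Points p
  natural : ∀ {p q : ℕ} (f : GrassmannHom p q) (x : V.Points p),
    app q (V.map f x) = W.map f (app p x)
  smooth : ∀ p : ℕ, IsEvenSmooth (app p)

theorem IsEvenSmooth.of_linear (φ : V.Points p →ₗ[Grassmann.evenPart p] W.Points p) :
    IsEvenSmooth (φ : V.Points p → W.Points p) := by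
  let ψ : V.Points p →L[ℝ] W.Points p := LinearMap.toContinuousLinearMap (φ.restrictScalars ℝ)
  have h : (φ : V.Points p → W.Points p) = ψ := rfl
  refine ⟨h ▸ ψ.contDiff, fun x c v => ?_⟩
  rw [h, ψ.fderiv]
  exact φ.map_smul c v

theorem IsEvenSmooth.comp {ψ : V.Points p → W.Points p} {φ : U.Points p → V.Points p}
    (hψ : IsEvenSmooth ψ) (hφ : IsEvenSmooth φ) : IsEvenSmooth (ψ ∘ φ) := by
  refine ⟨hψ.1.comp hφ.1, fun x c v => ?_⟩
  rw [fderiv_comp x (hψ.1.differentiable (by simp) _) (hφ.1.differentiable (by simp) _)]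
  simp only [ContinuousLinearMap.comp_apply, hφ.2, hψ.2]

theorem IsEvenSmooth.add {ψ φ : V.Points p → W.Points p}
    (hψ : IsEvenSmooth ψ) (hφ : IsEvenSmooth φ) : IsEvenSmooth (ψ + φ) := by
  refine ⟨hψ.1.add hφ.1, fun x c v => ?_⟩
  rw [fderiv_add (hψ.1.differentiable (by simp) _) (hφ.1.differentiable (by simp) _)]
  simp only [add_apply, hφ.2, hψ.2, smul_add]

/-- The category of the supermanifolds associated to super vector spaces, with smooth maps of
supermanifolds; it is a full subcategory of the category of supermanifolds, closed under finite
products. -/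
instance : Category (SuperVect.{u}) where
  Hom V W := Hom V W
  id V :=
    { app := fun _ x => x
      natural := fun _ _ => rfl
      smooth := fun _ => IsEvenSmooth.of_linear LinearMap.id }
  comp φ ψ :=
    { app := fun p x => ψ.app p (φ.app p x)
      natural := fun f x => by rw [φ.natural, ψ.natural]
      smooth := fun p => (ψ.smooth p).comp (φ.smooth p) }

/-- The component `φ_A : V_A → W_A` of a smooth map of supermanifolds. -/
def app (φ : V ⟶ W) (p : ℕ) : V.Points p → W.Points p := Hom.app φ p

theorem hom_ext {φ ψ : V ⟶ W} (h : ∀ p x, app φ p x = app ψ p x) : φ = ψ :=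
  Hom.ext (funext fun p => funext fun x => h p x)

theorem app_map (φ : V ⟶ W) (f : GrassmannHom p q) (x : V.Points p) :
    app φ q (V.map f x) = W.map f (app φ p x) := Hom.natural φ f x

@[simp] theorem comp_app (φ : U ⟶ V) (ψ : V ⟶ W) (p : ℕ) (x : U.Points p) :
    app (φ ≫ ψ) p x = app ψ p (app φ p x) := rfl

@[simp] theorem id_app (p : ℕ) (x : V.Points p) : app (𝟙 V) p x = x := rfl

theorem lTensor_mem (f : V.carrier →ₗ[ℝ] W.carrier)
    (hf : ∀ i x, x ∈ V.grade i → f x ∈ W.grade i) (t : V.Points p) :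
    f.baseChange (Grassmann p) t.1 ∈ W.evenTensor p := by
  induction t using Points.induction with
  | tmul i a ha x hx => exact tmul_mem_evenTensor ha (hf i x hx)
  | zero => exact (map_zero (f.baseChange (Grassmann p))) ▸ Submodule.zero_mem _
  | add s t hs ht =>
    have : (s + t).1 = s.1 + t.1 := rfl
    rw [this, map_add]
    exact Submodule.add_mem _ hs ht
  | smul r t ht =>
    have : (r • t).1 = r • t.1 := rfl
    rw [this, LinearMap.map_smul_of_tower]
    exact Submodule.smul_mem ((W.evenTensor p).restrictScalars ℝ) r ht

/-- The `A₀`-linear map `V_A → W_A` induced by a grade-preserving linear map `V → W`. -/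
noncomputable def linearApp (f : V.carrier →ₗ[ℝ] W.carrier)
    (hf : ∀ i x, x ∈ V.grade i → f x ∈ W.grade i) (p : ℕ) :
    V.Points p →ₗ[Grassmann.evenPart p] W.Points p where
  toFun t := ⟨f.baseChange (Grassmann p) t.1, lTensor_mem f hf t⟩
  map_add' s t := Subtype.ext (map_add (f.baseChange (Grassmann p)) s.1 t.1)
  map_smul' c t := Subtype.ext (map_smul (f.baseChange (Grassmann p)) (c : Grassmann p) t.1)

theorem linearApp_natural (f : V.carrier →ₗ[ℝ] W.carrier)
    (hf : ∀ i x, x ∈ V.grade i → f x ∈ W.grade i) (g : GrassmannHom p q) (t : V.Points p) :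
    linearApp f hf q (V.map g t) = W.map g (linearApp f hf p t) := by
  induction t using Points.induction with
  | tmul i a ha x hx => rfl
  | zero => simp only [map_zero]
  | add s t hs ht => simp only [map_add, hs, ht]
  | smul r t ht => simp only [map_smul, LinearMap.map_smul_of_tower, ht]

/-- The smooth map of supermanifolds induced by a grade-preserving linear map. -/
noncomputable def ofLinear (f : V.carrier →ₗ[ℝ] W.carrier)
    (hf : ∀ i x, x ∈ V.grade i → f x ∈ W.grade i) : V ⟶ W :=
  show Hom V W from
  { app := fun p => linearApp f hf p
    natural := fun g t => linearApp_natural f hf g t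
    smooth := fun p => IsEvenSmooth.of_linear (linearApp f hf p) }

/-- The super vector space `V ⊕ W`, whose associated supermanifold is `V × W`. -/
abbrev prod (V W : SuperVect.{u}) : SuperVect.{u} where
  carrier := V.carrier × W.carrier
  grade i := (V.grade i).prod (W.grade i)
  isCompl := by
    have hV := V.isCompl
    have hW := W.isCompl
    constructor
    · rw [Submodule.disjoint_def]
      rintro ⟨x, y⟩ ⟨hx, hy⟩ ⟨hx', hy'⟩
      exact Prod.ext (Submodule.disjoint_def.1 hV.disjoint x hx hx')
        (Submodule.disjoint_def.1 hW.disjoint y hy hy')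
    · rw [codisjoint_iff, Submodule.prod_sup_prod, hV.sup_eq_top, hW.sup_eq_top,
        Submodule.prod_top]

/-- The super vector space `ℝ^{0|0}`, whose associated supermanifold is the point. -/
abbrev point : SuperVect.{u} where
  carrier := PUnit.{u + 1}
  grade _ := ⊤
  isCompl := ⟨by rw [Submodule.disjoint_def]; intros; rfl, by simp⟩

theorem point_eq_zero (t : point.{u}.Points p) : t = 0 := by
  induction t using Points.induction with
  | tmul i a ha x hx =>
    apply Subtype.ext
    have : x = 0 := rfl
    subst this
    exact TensorProduct.tmul_zero _ _
  | zero => rfl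
  | add s t hs ht => rw [hs, ht, add_zero]
  | smul r t ht => rw [ht, smul_zero]

/-- The projection `V × W → V`. -/
noncomputable def prodFst (V W : SuperVect.{u}) : V.prod W ⟶ V :=
  ofLinear (LinearMap.fst ℝ V.carrier W.carrier) (fun _ _ hx => hx.1)

/-- The projection `V × W → W`. -/
noncomputable def prodSnd (V W : SuperVect.{u}) : V.prod W ⟶ W :=
  ofLinear (LinearMap.snd ℝ V.carrier W.carrier) (fun _ _ hx => hx.2)

/-- The `A`-point `(x, y)` of `V × W` with components `x ∈ V_A` and `y ∈ W_A`. -/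
noncomputable def pair (x : V.Points p) (y : W.Points p) : (V.prod W).Points p :=
  linearApp (W := V.prod W) (LinearMap.inl ℝ V.carrier W.carrier)
    (fun _ _ hx => ⟨hx, Submodule.zero_mem _⟩) p x +
  linearApp (W := V.prod W) (LinearMap.inr ℝ V.carrier W.carrier)
    (fun _ _ hy => ⟨Submodule.zero_mem _, hy⟩) p y

@[simp] theorem prodFst_pair (x : V.Points p) (y : W.Points p) :
    app (prodFst V W) p (pair x y) = x := by
  apply Subtype.ext
  change (LinearMap.fst ℝ V.carrier W.carrier).baseChange (Grassmann p)
    ((LinearMap.inl ℝ V.carrier W.carrier).baseChange (Grassmann p) x.1 +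
      (LinearMap.inr ℝ V.carrier W.carrier).baseChange (Grassmann p) y.1) = x.1
  rw [map_add, ← LinearMap.comp_apply, ← LinearMap.comp_apply, ← LinearMap.baseChange_comp,
    ← LinearMap.baseChange_comp]
  simp

@[simp] theorem prodSnd_pair (x : V.Points p) (y : W.Points p) :
    app (prodSnd V W) p (pair x y) = y := by
  apply Subtype.ext
  change (LinearMap.snd ℝ V.carrier W.carrier).baseChange (Grassmann p)
    ((LinearMap.inl ℝ V.carrier W.carrier).baseChange (Grassmann p) x.1 +
      (LinearMap.inr ℝ V.carrier W.carrier).baseChange (Grassmann p) y.1) = y.1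
  rw [map_add, ← LinearMap.comp_apply, ← LinearMap.comp_apply, ← LinearMap.baseChange_comp,
    ← LinearMap.baseChange_comp]
  simp

theorem pair_add (x x' : V.Points p) (y y' : W.Points p) :
    pair (x + x') (y + y') = pair x y + pair x' y' := by
  simp only [pair, map_add]
  abel

theorem pair_smul (r : ℝ) (x : V.Points p) (y : W.Points p) :
    pair (r • x) (r • y) = r • pair x y := by
  simp only [pair, LinearMap.map_smul_of_tower, smul_add]

theorem pair_app (t : (V.prod W).Points p) :
    pair (app (prodFst V W) p t) (app (prodSnd V W) p t) = t := by
  change pair (linearApp _ _ p t) (linearApp _ _ p t) = t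
  induction t using Points.induction with
  | tmul i a ha x hx =>
    apply Subtype.ext
    change a ⊗ₜ[ℝ] ((x.1, 0) : V.carrier × W.carrier) +
      a ⊗ₜ[ℝ] ((0, x.2) : V.carrier × W.carrier) = a ⊗ₜ[ℝ] x
    rw [← TensorProduct.tmul_add, Prod.mk_add_mk, add_zero, zero_add]
  | zero => simp only [pair, map_zero, add_zero]
  | add s t hs ht => rw [map_add, map_add, pair_add, hs, ht]
  | smul r t ht => rw [LinearMap.map_smul_of_tower, LinearMap.map_smul_of_tower, pair_smul, ht]

theorem map_pair (f : GrassmannHom p q) (x : V.Points p) (y : W.Points p) :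
    (V.prod W).map f (pair x y) = pair (V.map f x) (W.map f y) :=
  (map_add ((V.prod W).map f) _ _).trans
    (congrArg₂ (· + ·) (linearApp_natural _ _ f x).symm (linearApp_natural _ _ f y).symm)

/-- The smooth map `(φ, ψ) : U → V × W`. -/
noncomputable def prodLift (φ : U ⟶ V) (ψ : U ⟶ W) : U ⟶ V.prod W :=
  show Hom U (V.prod W) from
  { app := fun p x => pair (app φ p x) (app ψ p x)
    natural := fun f x => by rw [map_pair, app_map, app_map]
    smooth := fun p =>
      ((IsEvenSmooth.of_linear _).comp (Hom.smooth φ p)).add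
        ((IsEvenSmooth.of_linear _).comp (Hom.smooth ψ p)) }

theorem prodLift_app (φ : U ⟶ V) (ψ : U ⟶ W) (p : ℕ) (x : U.Points p) :
    app (prodLift φ ψ) p x = pair (app φ p x) (app ψ p x) := rfl

/-- The point is terminal and `V × W` is a product in the category of supermanifolds. -/
noncomputable instance : CartesianMonoidalCategory (SuperVect.{u}) :=
  .ofChosenFiniteProducts
    ⟨Limits.asEmptyCone point, Limits.IsTerminal.ofUniqueHom
      (fun _ => ofLinear 0 (fun _ _ _ => Submodule.zero_mem _))
      (fun _ _ => hom_ext fun _ _ => (point_eq_zero _).trans (point_eq_zero _).symm)⟩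
    fun V W =>
      ⟨Limits.BinaryFan.mk (prodFst V W) (prodSnd V W),
        Limits.BinaryFan.isLimitMk
          (fun s => prodLift s.fst s.snd)
          (fun s => hom_ext fun p x => prodFst_pair (app s.fst p x) (app s.snd p x))
          (fun s => hom_ext fun p x => prodSnd_pair (app s.fst p x) (app s.snd p x))
          (fun _ m h₁ h₂ => hom_ext fun p x => (pair_app (app m p x)).symm.trans
            (congrArg₂ pair (congrArg (fun g => app g p x) h₁)
              (congrArg (fun g => app g p x) h₂)))⟩

end SuperVect

/-! ### Lie superalgebras -/

/-- A finite-dimensional real Lie superalgebra. -/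
structure LieSuperalgebra : Type (u + 1) extends SuperVect.{u} where
  bracket : carrier →ₗ[ℝ] carrier →ₗ[ℝ] carrier
  bracket_mem : ∀ {i j : ZMod 2} {x y : carrier}, x ∈ grade i → y ∈ grade j →
    bracket x y ∈ grade (i + j)
  antisymm : ∀ {i j : ZMod 2} {x y : carrier}, x ∈ grade i → y ∈ grade j →
    bracket x y = -(superSign i j • bracket y x)
  jacobi : ∀ {i j k : ZMod 2} {x y z : carrier}, x ∈ grade i → y ∈ grade j → z ∈ grade k →
    bracket x (bracket y z) = bracket (bracket x y) z + superSign i j • bracket y (bracket x z)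

namespace LieSuperalgebra

variable (n : LieSuperalgebra.{u}) {p q : ℕ}

/-- `k`-step nilpotency: any `k` nested brackets `[x₁, [x₂, …, [x_k, y]…]]` vanish. -/
def IsStepNilpotent (k : ℕ) : Prop :=
  ∀ (l : List n.carrier) (y : n.carrier), l.length = k →
    l.foldr (fun x z => n.bracket x z) y = 0

/-- A Lie superalgebra is nilpotent if it is `k`-step nilpotent for some `k`. -/
def IsNilpotent : Prop := ∃ k : ℕ, n.IsStepNilpotent k

/-- The `A`-points `n_A = (A ⊗ n)₀`. -/
abbrev Points (p : ℕ) : Type u := n.toSuperVect.Points p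

/-- The bilinear map `(a ⊗ x, b ⊗ y) ↦ ba ⊗ [x, y]`. On the even part of `A ⊗ n` this is the rule
of signs, see `LieSuperalgebra.lie_tmul`. -/
noncomputable def tensorBracket (p : ℕ) :
    Grassmann p ⊗[ℝ] n.carrier →ₗ[ℝ] Grassmann p ⊗[ℝ] n.carrier →ₗ[ℝ]
      Grassmann p ⊗[ℝ] n.carrier :=
  TensorProduct.map₂ (LinearMap.mul ℝ (Grassmann p)).flip n.bracket

variable {n}

theorem tensorBracket_mem (s t : n.Points p) :
    n.tensorBracket p s.1 t.1 ∈ n.evenTensor p := by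
  induction s using SuperVect.Points.induction with
  | tmul i a ha x hx =>
    induction t using SuperVect.Points.induction with
    | tmul j b hb y hy =>
      have h₁ := CliffordAlgebra.evenOdd_mul_le (0 : QuadraticForm ℝ (Fin p → ℝ)) j i
        (Submodule.mul_mem_mul hb ha)
      rw [add_comm] at h₁
      exact SuperVect.tmul_mem_evenTensor h₁ (n.bracket_mem hx hy)
    | zero => exact (map_zero (n.tensorBracket p _)) ▸ Submodule.zero_mem _
    | add s t hs ht =>
      have : (s + t).1 = s.1 + t.1 := rfl
      rw [this, map_add]
      exact Submodule.add_mem _ hs ht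
    | smul r t ht =>
      have : (r • t).1 = r • t.1 := rfl
      rw [this, map_smul]
      exact Submodule.smul_mem ((n.evenTensor p).restrictScalars ℝ) r ht
  | zero =>
    have : (0 : n.Points p).1 = 0 := rfl
    rw [this, map_zero]
    exact Submodule.zero_mem _
  | add s t hs ht =>
    have : (s + t).1 = s.1 + t.1 := rfl
    rw [this, map_add]
    exact Submodule.add_mem _ hs ht
  | smul r t ht =>
    have : (r • t).1 = r • t.1 := rfl
    rw [this, map_smul]
    exact Submodule.smul_mem ((n.evenTensor p).restrictScalars ℝ) r ht

variable (n) in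
/-- The bracket `[-,-]_A` on `n_A`, as a real bilinear map. -/
noncomputable def pointsBracket (p : ℕ) : n.Points p →ₗ[ℝ] n.Points p →ₗ[ℝ] n.Points p :=
  LinearMap.mk₂ ℝ (fun s t => ⟨n.tensorBracket p s.1 t.1, tensorBracket_mem s t⟩)
    (fun s s' t => Subtype.ext (LinearMap.map_add₂ (n.tensorBracket p) s.1 s'.1 t.1))
    (fun r s t => Subtype.ext (LinearMap.map_smul₂ (n.tensorBracket p) r s.1 t.1))
    (fun s t t' => Subtype.ext (map_add (n.tensorBracket p s.1) t.1 t'.1))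
    (fun r s t => Subtype.ext (map_smul (n.tensorBracket p s.1) r t.1))

theorem pointsBracket_swap (s t : n.Points p) :
    n.pointsBracket p s t = -n.pointsBracket p t s := by
  induction s using SuperVect.Points.induction with
  | tmul i a ha x hx =>
    induction t using SuperVect.Points.induction with
    | tmul j b hb y hy =>
      apply Subtype.ext
      change (b * a) ⊗ₜ[ℝ] n.bracket x y = -((a * b) ⊗ₜ[ℝ] n.bracket y x)
      rw [n.antisymm hx hy, Grassmann.mul_comm_sign ha hb, TensorProduct.tmul_neg,
        TensorProduct.tmul_smul, TensorProduct.smul_tmul']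
    | zero => simp only [map_zero, LinearMap.zero_apply, neg_zero]
    | add s t hs ht => simp only [map_add, LinearMap.add_apply, hs, ht, neg_add]
    | smul r t ht => simp only [map_smul, LinearMap.smul_apply, ht, smul_neg]
  | zero => simp only [map_zero, LinearMap.zero_apply, neg_zero]
  | add s t hs ht => simp only [map_add, LinearMap.add_apply, hs, ht, neg_add]
  | smul r t ht => simp only [map_smul, LinearMap.smul_apply, ht, smul_neg]

theorem pointsBracket_jacobi (s t w : n.Points p) :
    n.pointsBracket p s (n.pointsBracket p t w) =
      n.pointsBracket p (n.pointsBracket p s t) w +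
        n.pointsBracket p t (n.pointsBracket p s w) := by
  induction s using SuperVect.Points.induction with
  | tmul i a ha x hx =>
    induction t using SuperVect.Points.induction with
    | tmul j b hb y hy =>
      induction w using SuperVect.Points.induction with
      | tmul k c hc z hz =>
        apply Subtype.ext
        change ((c * b) * a) ⊗ₜ[ℝ] n.bracket x (n.bracket y z) =
          (c * (b * a)) ⊗ₜ[ℝ] n.bracket (n.bracket x y) z +
            ((c * a) * b) ⊗ₜ[ℝ] n.bracket y (n.bracket x z)
        rw [n.jacobi hx hy hz, mul_assoc c a b, Grassmann.mul_comm_sign ha hb, mul_assoc c b a,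
          TensorProduct.tmul_add, TensorProduct.tmul_smul, Algebra.mul_smul_comm,
          TensorProduct.smul_tmul']
      | zero => simp only [map_zero, add_zero]
      | add s t hs ht => simp only [map_add, hs, ht]; abel
      | smul r t ht => simp only [map_smul, ht, smul_add]
    | zero => simp only [map_zero, LinearMap.zero_apply, add_zero]
    | add s t hs ht => simp only [map_add, LinearMap.add_apply, hs, ht]; abel
    | smul r t ht => simp only [map_smul, LinearMap.smul_apply, ht, smul_add]
  | zero => simp only [map_zero, LinearMap.zero_apply, add_zero]
  | add s t hs ht => simp only [map_add, LinearMap.add_apply, hs, ht]; abel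
  | smul r t ht => simp only [map_smul, LinearMap.smul_apply, ht, smul_add]

noncomputable instance : LieRing (n.Points p) where
  bracket s t := n.pointsBracket p s t
  add_lie s t w := LinearMap.map_add₂ (n.pointsBracket p) s t w
  lie_add s t w := map_add (n.pointsBracket p s) t w
  lie_self s := by
    have h := pointsBracket_swap s s
    have h₂ : (2 : ℝ) • n.pointsBracket p s s = 0 := by
      rw [two_smul]
      nth_rewrite 1 [h]
      exact neg_add_cancel _
    exact (smul_eq_zero.1 h₂).resolve_left two_ne_zero
  leibniz_lie s t w := pointsBracket_jacobi s t w

noncomputable instance : LieAlgebra ℝ (n.Points p) where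
  lie_smul r s t := map_smul (n.pointsBracket p s) r t

/-- `n_A` is a Lie algebra over the commutative ring `A₀`. -/
noncomputable instance : LieAlgebra (Grassmann.evenPart p) (n.Points p) where
  lie_smul c s t := by
    apply Subtype.ext
    change n.tensorBracket p s.1 ((c : Grassmann p) • t.1) =
      (c : Grassmann p) • n.tensorBracket p s.1 t.1
    generalize s.1 = s'
    generalize t.1 = t'
    induction s' using TensorProduct.induction_on with
    | zero => simp only [map_zero, LinearMap.zero_apply, smul_zero]
    | add x y hx hy => simp only [map_add, LinearMap.add_apply, hx, hy, smul_add]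
    | tmul a x =>
      induction t' using TensorProduct.induction_on with
      | zero => simp only [map_zero, smul_zero]
      | add x y hx hy => simp only [map_add, hx, hy, smul_add]
      | tmul b y =>
        change (((c : Grassmann p) * b) * a) ⊗ₜ[ℝ] n.bracket x y =
          ((c : Grassmann p) * (b * a)) ⊗ₜ[ℝ] n.bracket x y
        rw [mul_assoc]

/-- The bracket of `n_A` is `[a ⊗ x, b ⊗ y]_A = (-1)^(|x||b|) ab ⊗ [x, y]`. -/
theorem lie_tmul {i j : ZMod 2} {a b : Grassmann p} {x y : n.carrier}
    (ha : a ∈ Grassmann.part p i) (hx : x ∈ n.grade i)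
    (hb : b ∈ Grassmann.part p j) (hy : y ∈ n.grade j) :
    ⁅(SuperVect.tmul ha hx : n.Points p), (SuperVect.tmul hb hy : n.Points p)⁆.1 =
      superSign i j • ((a * b) ⊗ₜ[ℝ] n.bracket x y) := by
  change (b * a) ⊗ₜ[ℝ] n.bracket x y = _
  rw [Grassmann.mul_comm_sign hb ha, superSign_comm, TensorProduct.smul_tmul']

end LieSuperalgebra

/-! ### The Baker–Campbell–Hausdorff series -/

section BCH

variable {L : Type*} [LieRing L] [LieAlgebra ℝ L]

/-- The right-nested bracket `[x₁, [x₂, …, [x_{m-1}, x_m]…]]` of a word. -/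
def nestedLie : List L → L
  | [] => 0
  | [x] => x
  | x :: y :: l => ⁅x, nestedLie (y :: l)⁆

/-- The word `X^{r₁} Y^{s₁} ⋯ X^{r_k} Y^{s_k}`, for `(r_i, s_i) = e i`. -/
def bchWord (X Y : L) {k : ℕ} (e : Fin k → ℕ × ℕ) : List L :=
  (List.ofFn fun i => List.replicate (e i).1 X ++ List.replicate (e i).2 Y).flatten

/-- The degree `d` component of the Baker–Campbell–Hausdorff series `log (exp X exp Y)`, in Dynkin's
form: the sum over `k ≥ 1` and over `(r₁, s₁), …, (r_k, s_k)` with `r_i + s_i > 0` and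
`∑ (r_i + s_i) = d` of
`(-1)^(k-1) / (k d ∏ r_i! s_i!) [X^{r₁} Y^{s₁} ⋯ X^{r_k} Y^{s_k}]`. -/
noncomputable def bchTerm (d : ℕ) (X Y : L) : L :=
  ∑ k ∈ Finset.Icc 1 d,
    ∑ e ∈ (Fintype.piFinset fun _ : Fin k => Finset.range (d + 1) ×ˢ Finset.range (d + 1)) with
        (∀ i, 0 < (e i).1 + (e i).2) ∧ ∑ i, ((e i).1 + (e i).2) = d,
      ((-1 : ℝ) ^ (k - 1) / (k * d * ∏ i, (((e i).1.factorial : ℝ) * ((e i).2.factorial : ℝ)))) •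
        nestedLie (bchWord X Y e)

/-- The Baker–Campbell–Hausdorff series `Z(X, Y) = X + Y + ½[X, Y] + ⋯`, for `X`, `Y` such that only
finitely many of its terms are nonzero. -/
noncomputable def bch (X Y : L) : L := ∑ᶠ d : ℕ, bchTerm d X Y

end BCH

/-! ### Power series identities relating the exponential and the logarithm -/

namespace PowerSeries

/-! Nilpotency passes to points because a nested bracket in `A ⊗ n` is a sum of tensors `a ⊗ w`,
with `w` an equally deep nested bracket in `n` (`foldr_lie_mem_span`). A word of length `d > k` is
`d - 1 ≥ k` brackets applied to a last letter, so the series stops at degree `k`. Each term is a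
combination of iterated brackets, hence natural in `A` and `A₀`-smooth. What remains is the group
law, chiefly associativity.

In a nilpotent associative algebra `exp (Z(x, y)) = exp x * exp y` (`NilFiltration.exp_bchSum`).
Replace `x, y` by `tx, ty` in `B[t]`, where `D = t d/dt` multiplies the degree `d` term by `d`, and
put `z = log (exp x * exp y)`. Differentiating `exp z` gives `((e^{ad z} - 1) / ad z) (D z) = x +
e^{ad x} y`. Since `e^{ad z} = e^{ad x} e^{ad y}`, inverting the operator gives `D z = (log (1 + u)
/ u) (x + e^{ad x} y)` with `u = e^{ad x} e^{ad y} - 1`. Expanded into words, the right side is `∑ d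
• bchTerm d`, which is Dynkin's formula; `D` is injective on polynomials without constant term, and
`t = 1` finishes.

To carry this to a nilpotent Lie algebra `L`, a representation that loses no information is needed,
and `ad` forgets the centre. A differentiable curve `f` in `L` acts at each time `t` on `L × ℝ` by
`(v, s) ↦ ([f t, v] + s f' t, 0)`, nilpotently and compatibly with brackets. Its exponential
determines `f' t`, so these operators together with `f 0` determine `f` (`curves_ext`). Group
identities thus hold for the curves `t ↦ t X`, because they hold for products of exponentials, and
`t = 1` gives them in `L`. -/

theorem one_add_X_mul_mk_neg_one_pow :
    (1 + X : ℝ⟦X⟧) * mk (fun n => algebraMap ℚ ℝ ((-1 : ℚ) ^ n)) = 1 := by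
  ext n
  rw [add_mul, one_mul, map_add]
  cases n with
  | zero => simp
  | succ n => simp [coeff_succ_X_mul, coeff_one, pow_succ]

/-- Both sides vanish at `0`, and by the chain rule the left side has derivative `exp / (1 + (exp -
1)) = 1`. -/
theorem log_subst_exp_sub_one : (log ℝ).subst (exp ℝ - 1) = (X : ℝ⟦X⟧) := by
  have hs : HasSubst (exp ℝ - 1) := HasSubst.exp_sub_one
  apply derivative.ext
  · rw [derivative_subst hs, deriv_log]
    have h := congrArg (fun f : ℝ⟦X⟧ => f.subst (exp ℝ - 1)) one_add_X_mul_mk_neg_one_pow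
    simp only [subst_mul hs, subst_add hs, subst_X hs] at h
    have h1 : (1 : ℝ⟦X⟧).subst (exp ℝ - 1) = (1 : ℝ⟦X⟧) := by
      rw [← coe_substAlgHom hs, map_one]
    rw [h1] at h
    rw [map_sub, derivative_exp, derivative_X, mul_comm]
    simpa using h
  · rw [constantCoeff_X]
    exact constantCoeff_subst_eq_zero
      (by rw [map_sub, map_one, ← constantCoeff_eq, constantCoeff_exp, sub_self]) _
      constantCoeff_log

/-- With `m = 1 / (1 + X)`, the composite `h` satisfies `h' = h m`, while `m' = -m²`. Hence `h m`
has derivative zero and is the constant `1`. -/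
theorem exp_subst_log : (exp ℝ).subst (log ℝ) = (1 + X : ℝ⟦X⟧) := by
  have hs : HasSubst (log ℝ) := HasSubst.log
  set h := (exp ℝ).subst (log ℝ) with hh
  set m : ℝ⟦X⟧ := mk (fun n => algebraMap ℚ ℝ ((-1 : ℚ) ^ n)) with hm
  have hmX : (1 + X) * m = 1 := one_add_X_mul_mk_neg_one_pow
  have hd : derivative ℝ h = h * m := by
    rw [hh, derivative_subst hs, derivative_exp, deriv_log]
  have hdm : derivative ℝ m = -(m * m) := by
    have h1 := congrArg (derivative ℝ) hmX
    simp only [Derivation.leibniz, map_add, derivative_X, smul_eq_mul, Derivation.map_one_eq_zero,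
      zero_add, mul_one] at h1
    linear_combination m * h1 - derivative ℝ m * hmX
  have hg : h * m = 1 := by
    apply derivative.ext
    · rw [Derivation.leibniz, hd, hdm, Derivation.map_one_eq_zero]
      simp only [smul_eq_mul]
      ring
    · have h0 : constantCoeff h = 1 := by
        have h1 : constantCoeff (h - 1) = 0 := by
          have h2 : h - 1 = (exp ℝ - 1).subst (log ℝ) := by
            rw [subst_sub hs, ← coe_substAlgHom hs, map_one, coe_substAlgHom hs]
          rw [h2]
          exact constantCoeff_subst_eq_zero constantCoeff_log _ (by simp [constantCoeff_exp])
        rw [map_sub, map_one, sub_eq_zero] at h1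
        exact h1
      rw [map_mul, h0, hm]
      simp
  linear_combination (1 + X) * hg - h * hmX

/-- The power series `(exp X - 1) / X`. -/
noncomputable def expQuot : ℝ⟦X⟧ := mk fun n => ((n + 1).factorial : ℝ)⁻¹

/-- The power series `log (1 + X) / X`. -/
noncomputable def logQuot : ℝ⟦X⟧ := mk fun n => (-1 : ℝ) ^ n / (n + 1)

theorem coeff_exp_real (n : ℕ) : coeff n (exp ℝ) = (n.factorial : ℝ)⁻¹ := by
  simp [coeff_exp]

theorem X_mul_expQuot : X * expQuot = exp ℝ - 1 := by
  ext n
  cases n with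
  | zero => simp [constantCoeff_exp]
  | succ n => simp [coeff_succ_X_mul, expQuot, coeff_one]

theorem X_mul_logQuot : X * logQuot = log ℝ := by
  ext n
  cases n with
  | zero => simp
  | succ n => simp [coeff_succ_X_mul, logQuot, pow_succ]

/-- This is `log (exp X) = X` with one factor `X` cancelled. It serves to invert the operator
`(e^{ad z} - 1) / ad z`. -/
theorem logQuot_subst_mul_expQuot : logQuot.subst (exp ℝ - 1) * expQuot = 1 := by
  have hs : HasSubst (exp ℝ - 1) := HasSubst.exp_sub_one
  have h := log_subst_exp_sub_one
  rw [← X_mul_logQuot, subst_mul hs, subst_X hs, ← X_mul_expQuot] at h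
  have hX : (X : ℝ⟦X⟧) ≠ 0 := X_ne_zero
  apply mul_left_cancel₀ hX
  rw [← X_mul_expQuot]
  linear_combination h

/-! ### Evaluation of power series at nilpotent elements -/

section Eval

variable {R : Type*} [Ring R] [Algebra ℝ R]

/-- The value of a power series, truncated at degree `M`, at an element of an algebra. -/
noncomputable def evalTrunc (M : ℕ) (f : ℝ⟦X⟧) (a : R) : R :=
  ∑ i ∈ Finset.range M, coeff i f • a ^ i

theorem evalTrunc_eq_aeval (M : ℕ) (f : ℝ⟦X⟧) (a : R) :
    evalTrunc M f a = Polynomial.aeval a (trunc M f) := by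
  rw [Polynomial.aeval_def, eval₂_trunc_eq_sum_range]
  exact Finset.sum_congr rfl fun i _ => Algebra.smul_def _ _

theorem evalTrunc_eq_of_le {m M : ℕ} {a : R} (ha : a ^ m = 0) (h : m ≤ M) (f : ℝ⟦X⟧) :
    evalTrunc M f a = evalTrunc m f a := by
  refine (Finset.sum_subset (Finset.range_subset_range.2 h) fun i _ hi => ?_).symm
  rw [pow_eq_zero_of_le (not_lt.1 fun h' => hi (Finset.mem_range.2 h')) ha, smul_zero]

theorem aeval_eq_zero_of_coeff {M : ℕ} {a : R} (ha : a ^ M = 0) {P : Polynomial ℝ}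
    (hP : ∀ d < M, P.coeff d = 0) : Polynomial.aeval a P = 0 := by
  obtain ⟨Q, rfl⟩ := Polynomial.X_pow_dvd_iff.2 hP
  rw [map_mul, map_pow, Polynomial.aeval_X, ha, zero_mul]

/-- Evaluation of power series at a nilpotent element, as an algebra homomorphism. -/
noncomputable def evalNil (M : ℕ) (a : R) (ha : a ^ M = 0) : ℝ⟦X⟧ →ₐ[ℝ] R :=
  AlgHom.ofLinearMap
    { toFun := fun f => evalTrunc M f a
      map_add' := fun f g => by
        simp only [evalTrunc, map_add, add_smul, Finset.sum_add_distrib]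
      map_smul' := fun r f => by
        simp only [evalTrunc, map_smul, Finset.smul_sum, smul_eq_mul, mul_smul, RingHom.id_apply] }
    (by
      change evalTrunc M 1 a = 1
      cases M with
      -- For `M = 0` the hypothesis reads `1 = 0`, so the ring is trivial.
      | zero => rw [pow_zero] at ha; rw [← mul_one (evalTrunc _ _ _), ha, mul_zero]
      | succ M => rw [evalTrunc_eq_aeval, trunc_one, map_one])
    (fun f g => by
      change evalTrunc M (f * g) a = evalTrunc M f a * evalTrunc M g a
      rw [evalTrunc_eq_aeval, evalTrunc_eq_aeval, evalTrunc_eq_aeval, ← map_mul, ← sub_eq_zero,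
        ← map_sub]
      -- The truncated product and the product of truncations agree below degree `M`, so their
      -- difference is a multiple of `X ^ M`.
      refine aeval_eq_zero_of_coeff ha fun d hd => ?_
      rw [Polynomial.coeff_sub, coeff_trunc, if_pos hd, coeff_mul_eq_coeff_trunc_mul_trunc f g hd,
        ← Polynomial.coe_mul, Polynomial.coeff_coe, sub_self])

theorem evalNil_apply {M : ℕ} {a : R} (ha : a ^ M = 0) (f : ℝ⟦X⟧) :
    evalNil M a ha f = evalTrunc M f a := rfl

theorem evalTrunc_mul {M : ℕ} {a : R} (ha : a ^ M = 0) (f g : ℝ⟦X⟧) :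
    evalTrunc M (f * g) a = evalTrunc M f a * evalTrunc M g a :=
  map_mul (evalNil M a ha) f g

theorem evalTrunc_one {M : ℕ} {a : R} (ha : a ^ M = 0) : evalTrunc M 1 a = 1 :=
  map_one (evalNil M a ha)

theorem evalTrunc_add (M : ℕ) (a : R) (f g : ℝ⟦X⟧) :
    evalTrunc M (f + g) a = evalTrunc M f a + evalTrunc M g a := by
  simp only [evalTrunc, map_add, add_smul, Finset.sum_add_distrib]

theorem evalTrunc_sub (M : ℕ) (a : R) (f g : ℝ⟦X⟧) :
    evalTrunc M (f - g) a = evalTrunc M f a - evalTrunc M g a := by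
  simp only [evalTrunc, map_sub, sub_smul, Finset.sum_sub_distrib]

theorem evalTrunc_X {M : ℕ} {a : R} (ha : a ^ M = 0) : evalTrunc M X a = a := by
  -- Truncation at `M ≤ 1` would kill `X`; raising the degree by `2` keeps it and leaves the value
  -- unchanged.
  rw [← evalTrunc_eq_of_le ha (Nat.le_add_right M 2), evalTrunc_eq_aeval, trunc_X,
    Polynomial.aeval_X]

theorem evalTrunc_pow_eq_zero {M : ℕ} {a : R} (ha : a ^ M = 0) {g : ℝ⟦X⟧}
    (hg : constantCoeff g = 0) : evalTrunc M g a ^ M = 0 := by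
  obtain ⟨h, rfl⟩ := X_dvd_iff.2 hg
  rw [evalTrunc_mul ha, evalTrunc_X ha, Commute.mul_pow, ha, zero_mul]
  exact Commute.sum_right _ _ _ fun i _ => ((Commute.refl a).pow_right i).smul_right _

/-- Split `f` into its truncation and a multiple of `X ^ M`. The latter becomes a multiple of `g ^
M`, whose value at `a` is zero; for the polynomial part, evaluation is an algebra homomorphism. -/
theorem evalTrunc_subst {M : ℕ} {a : R} (ha : a ^ M = 0) {g : ℝ⟦X⟧}
    (hg : constantCoeff g = 0) (f : ℝ⟦X⟧) :
    evalTrunc M (f.subst g) a = evalTrunc M f (evalTrunc M g a) := by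
  have hs : HasSubst g := HasSubst.of_constantCoeff_zero' hg
  conv_lhs => rw [eq_X_pow_mul_shift_add_trunc M f]
  rw [subst_add hs, subst_mul hs, subst_pow hs, subst_X hs, subst_coe hs, ← evalNil_apply ha,
    map_add, map_mul, map_pow, evalNil_apply, evalTrunc_pow_eq_zero ha hg, zero_mul, zero_add,
    ← Polynomial.aeval_algHom_apply, evalNil_apply, ← evalTrunc_eq_aeval]

theorem evalTrunc_exp_log {M : ℕ} {a : R} (ha : a ^ M = 0) :
    evalTrunc M (exp ℝ) (evalTrunc M (log ℝ) a) = 1 + a := by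
  rw [← evalTrunc_subst ha constantCoeff_log, exp_subst_log, evalTrunc_add, evalTrunc_one ha,
    evalTrunc_X ha]

theorem evalTrunc_log_exp {M : ℕ} {a : R} (ha : a ^ M = 0) :
    evalTrunc M (log ℝ) (evalTrunc M (exp ℝ) a - 1) = a := by
  rw [← evalTrunc_one ha, ← evalTrunc_sub, ← evalTrunc_subst ha (by simp [constantCoeff_exp]),
    log_subst_exp_sub_one, evalTrunc_X ha]

theorem evalTrunc_exp_injective {M : ℕ} {a b : R} (ha : a ^ M = 0) (hb : b ^ M = 0)
    (h : evalTrunc M (exp ℝ) a = evalTrunc M (exp ℝ) b) : a = b := by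
  rw [← evalTrunc_log_exp ha, h, evalTrunc_log_exp hb]

theorem evalTrunc_logQuot_mul_expQuot {M : ℕ} {a : R} (ha : a ^ M = 0) :
    evalTrunc M logQuot (evalTrunc M (exp ℝ) a - 1) * evalTrunc M expQuot a = 1 := by
  rw [← evalTrunc_one ha, ← evalTrunc_sub, ← evalTrunc_subst ha (by simp [constantCoeff_exp]),
    ← evalTrunc_mul ha, logQuot_subst_mul_expQuot]

theorem evalTrunc_zero_right {M : ℕ} (hM : M ≠ 0) (f : ℝ⟦X⟧) :
    evalTrunc M f (0 : R) = algebraMap ℝ R (constantCoeff f) := by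
  rw [evalTrunc_eq_of_le (pow_one 0) (Nat.one_le_iff_ne_zero.2 hM)]
  simp [evalTrunc, Algebra.algebraMap_eq_smul_one]

theorem map_evalTrunc {S : Type*} [Ring S] [Algebra ℝ S] (φ : R →ₐ[ℝ] S) (M : ℕ) (f : ℝ⟦X⟧)
    (a : R) : φ (evalTrunc M f a) = evalTrunc M f (φ a) := by
  simp only [evalTrunc, map_sum, map_smul, map_pow]

/-- The square of exponents is regrouped by total degree; antidiagonal terms outside the square
vanish by nilpotency. -/
theorem evalTrunc_mul_evalTrunc {M : ℕ} {a b : R} (ha : a ^ M = 0) (hb : b ^ M = 0)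
    (f g : ℝ⟦X⟧) :
    evalTrunc M f a * evalTrunc M g b =
      ∑ n ∈ Finset.range (2 * M), ∑ p ∈ Finset.HasAntidiagonal.antidiagonal n,
        (coeff p.1 f * coeff p.2 g) • (a ^ p.1 * b ^ p.2) := by
  have h0 : ∀ n ∈ Finset.range (2 * M), ∑ p ∈ Finset.HasAntidiagonal.antidiagonal n,
        (coeff p.1 f * coeff p.2 g) • (a ^ p.1 * b ^ p.2) =
      ∑ p ∈ Finset.range M ×ˢ Finset.range M with p.1 + p.2 = n,
        (coeff p.1 f * coeff p.2 g) • (a ^ p.1 * b ^ p.2) := by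
    intro n _
    symm
    apply Finset.sum_subset
    · intro p hp
      exact Finset.HasAntidiagonal.mem_antidiagonal.2 (Finset.mem_filter.1 hp).2
    · intro p hp hp'
      rw [Finset.HasAntidiagonal.mem_antidiagonal] at hp
      simp only [Finset.mem_filter, Finset.mem_product, Finset.mem_range, hp, and_true,
        not_and_or, not_lt] at hp'
      rcases hp' with h | h
      · rw [pow_eq_zero_of_le h ha, zero_mul, smul_zero]
      · rw [pow_eq_zero_of_le h hb, mul_zero, smul_zero]
  rw [Finset.sum_congr rfl h0, Finset.sum_fiberwise_of_maps_to, evalTrunc, evalTrunc,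
    Finset.sum_mul_sum, Finset.sum_product]
  · refine Finset.sum_congr rfl fun i _ => Finset.sum_congr rfl fun j _ => ?_
    rw [smul_mul_smul_comm]
  · intro p hp
    simp only [Finset.mem_product, Finset.mem_range] at hp ⊢
    omega

theorem inv_factorial_smul_add_pow {a b : R} (hab : Commute a b) (n : ℕ) :
    (n.factorial : ℝ)⁻¹ • (a + b) ^ n = ∑ p ∈ Finset.HasAntidiagonal.antidiagonal n,
      (coeff p.1 (exp ℝ) * coeff p.2 (exp ℝ)) • (a ^ p.1 * b ^ p.2) := by
  rw [hab.add_pow', Finset.smul_sum]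
  refine Finset.sum_congr rfl fun p hp => ?_
  rw [← Nat.cast_smul_eq_nsmul ℝ, smul_smul, coeff_exp_real, coeff_exp_real]
  congr 1
  rw [← Finset.HasAntidiagonal.mem_antidiagonal.1 hp]
  have h := Nat.add_choose_mul_factorial_mul_factorial p.1 p.2
  rw [← Nat.choose_symm_add] at h
  have h1 : (p.1.factorial : ℝ) ≠ 0 := Nat.cast_ne_zero.2 p.1.factorial_ne_zero
  have h2 : (p.2.factorial : ℝ) ≠ 0 := Nat.cast_ne_zero.2 p.2.factorial_ne_zero
  have h3 : ((p.1 + p.2).factorial : ℝ) ≠ 0 := Nat.cast_ne_zero.2 (p.1 + p.2).factorial_ne_zero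
  field_simp
  rw [← h]
  push_cast
  ring

theorem evalTrunc_exp_add {M : ℕ} {a b : R} (hab : Commute a b) (ha : a ^ M = 0)
    (hb : b ^ M = 0) :
    evalTrunc (2 * M) (exp ℝ) (a + b) = evalTrunc M (exp ℝ) a * evalTrunc M (exp ℝ) b := by
  rw [evalTrunc_mul_evalTrunc ha hb, evalTrunc]
  refine Finset.sum_congr rfl fun n _ => ?_
  rw [coeff_exp_real, inv_factorial_smul_add_pow hab]

theorem evalTrunc_exp_mul_exp_neg {M : ℕ} {a : R} (ha : a ^ M = 0) :
    evalTrunc M (exp ℝ) a * evalTrunc M (exp ℝ) (-a) = 1 := by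
  have hM : M ≠ 0 ∨ M = 0 := (ne_or_eq M 0)
  rcases hM with hM | rfl
  · rw [← evalTrunc_exp_add (Commute.neg_right rfl) ha (by rw [neg_pow, ha, mul_zero]),
      add_neg_cancel, evalTrunc_zero_right (by omega), constantCoeff_exp, map_one]
  · rw [pow_zero] at ha
    rw [← mul_one (_ * _), ha, mul_zero]

/-- `∑ aⁱ rʲ / ((i+1)! j!) = ∑ (a + r)ⁱ rʲ / (n+1)!`, the sums being over `i + j = n`. -/
theorem sum_antidiagonal_expQuot {a r : R} (h : Commute a r) (n : ℕ) :
    ∑ p ∈ Finset.HasAntidiagonal.antidiagonal n,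
        (coeff p.1 expQuot * coeff p.2 (exp ℝ)) • (a ^ p.1 * r ^ p.2) =
      ((n + 1).factorial : ℝ)⁻¹ •
        ∑ p ∈ Finset.HasAntidiagonal.antidiagonal n, (a + r) ^ p.1 * r ^ p.2 := by
  have hf : ∀ k : ℕ, (k.factorial : ℝ) ≠ 0 := fun k => Nat.cast_ne_zero.2 k.factorial_ne_zero
  induction n with
  | zero => simp [expQuot]
  | succ n ih =>
    have hn : ((n + 2 : ℕ) : ℝ) ≠ 0 := by positivity
    apply smul_right_injective R hn
    dsimp only
    -- For `i + j = n + 1` write `n + 2 = (i + 1) + j`. The factor `i + 1` turns `1/(i+1)!` into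
    -- `1/i!`, giving a binomial sum; the factor `j` turns `1/j!` into `1/(j-1)!`, giving the sum of
    -- degree `n` times `r`.
    have key : ((n + 2 : ℕ) : ℝ) • ∑ p ∈ Finset.HasAntidiagonal.antidiagonal (n + 1),
        (coeff p.1 expQuot * coeff p.2 (exp ℝ)) • (a ^ p.1 * r ^ p.2) =
        ∑ p ∈ Finset.HasAntidiagonal.antidiagonal (n + 1),
          (coeff p.1 (exp ℝ) * coeff p.2 (exp ℝ)) • (a ^ p.1 * r ^ p.2) +
        (∑ p ∈ Finset.HasAntidiagonal.antidiagonal n,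
          (coeff p.1 expQuot * coeff p.2 (exp ℝ)) • (a ^ p.1 * r ^ p.2)) * r := by
      have e1 : (∑ p ∈ Finset.HasAntidiagonal.antidiagonal n,
          (coeff p.1 expQuot * coeff p.2 (exp ℝ)) • (a ^ p.1 * r ^ p.2)) * r =
          ∑ p ∈ Finset.HasAntidiagonal.antidiagonal (n + 1),
            (p.2 : ℝ) • (coeff p.1 expQuot * coeff p.2 (exp ℝ)) • (a ^ p.1 * r ^ p.2) := by
        rw [Finset.Nat.antidiagonal_succ', Finset.sum_cons, Finset.sum_map]
        simp only [Nat.cast_zero, zero_smul, zero_add, Finset.sum_mul]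
        refine Finset.sum_congr rfl fun p _ => ?_
        simp only [Function.Embedding.prodMap, Function.Embedding.coeFn_mk, Prod.map,
          Function.Embedding.refl_apply]
        rw [smul_mul_assoc, mul_assoc, ← pow_succ, smul_smul]
        congr 1
        rw [coeff_exp_real, coeff_exp_real, Nat.succ_eq_add_one, Nat.factorial_succ]
        push_cast
        have := hf p.2
        field_simp
      rw [e1, Finset.smul_sum, ← Finset.sum_add_distrib]
      refine Finset.sum_congr rfl fun p hp => ?_
      rw [smul_smul, smul_smul, ← add_smul]
      congr 1
      have hp' : n + 2 = p.1 + 1 + p.2 := by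
        have := Finset.HasAntidiagonal.mem_antidiagonal.1 hp
        omega
      rw [hp', expQuot, coeff_mk, coeff_exp_real, coeff_exp_real, Nat.factorial_succ]
      have h1 := hf p.1
      have h2 := hf p.2
      push_cast
      have h3 : (p.1 : ℝ) + 1 ≠ 0 := by positivity
      field_simp
    rw [key, ih]
    rw [← inv_factorial_smul_add_pow h, Finset.Nat.antidiagonal_succ', Finset.sum_cons,
      Finset.sum_map, smul_smul, Nat.factorial_succ (n + 1), smul_mul_assoc, ← smul_add]
    congr 1
    · have := hf (n + 1)
      push_cast
      have h3 : (n : ℝ) + 1 + 1 ≠ 0 := by positivity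
      have h4 : (n : ℝ) + 2 ≠ 0 := by positivity
      field_simp
      ring
    · rw [pow_zero, mul_one, Finset.sum_mul]
      congr 1
      refine Finset.sum_congr rfl fun p _ => ?_
      simp only [Function.Embedding.prodMap, Function.Embedding.coeFn_mk, Prod.map,
          Function.Embedding.refl_apply]
      rw [mul_assoc, ← pow_succ]

/-- Intended for `a = ad z` and `r` the right multiplication by `z`: then `a + r` is left
multiplication, and the right side is the Leibniz expansion of the derivative of `exp z`. -/
theorem evalTrunc_expQuot_mul_exp {M : ℕ} {a r : R} (h : Commute a r) (ha : a ^ M = 0)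
    (hr : r ^ M = 0) :
    evalTrunc M expQuot a * evalTrunc M (exp ℝ) r =
      ∑ n ∈ Finset.range (2 * M), ((n + 1).factorial : ℝ)⁻¹ •
        ∑ p ∈ Finset.HasAntidiagonal.antidiagonal n, (a + r) ^ p.1 * r ^ p.2 := by
  rw [evalTrunc_mul_evalTrunc ha hr]
  exact Finset.sum_congr rfl fun n _ => sum_antidiagonal_expQuot h n

end Eval

end PowerSeries

/-! ### Combinatorics of the Baker–Campbell–Hausdorff series -/

section Words

variable {L : Type*} [LieRing L] [LieAlgebra ℝ L]

open LieAlgebra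

omit [LieAlgebra ℝ L] in
theorem nestedLie_cons (x : L) {l : List L} (hl : l ≠ []) :
    nestedLie (x :: l) = ⁅x, nestedLie l⁆ := by
  cases l with
  | nil => exact absurd rfl hl
  | cons y l => rfl

theorem nestedLie_replicate_append (x : L) (r : ℕ) {l : List L} (hl : l ≠ []) :
    nestedLie (List.replicate r x ++ l) = (ad ℝ L x ^ r) (nestedLie l) := by
  induction r with
  | zero => simp
  | succ r ih =>
    rw [List.replicate_succ, List.cons_append, nestedLie_cons x (by simp [hl]), ih, pow_succ']
    rfl

omit [LieAlgebra ℝ L] in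
theorem nestedLie_eq_foldr (l : List L) (y : L) :
    nestedLie (l ++ [y]) = l.foldr (fun x z => ⁅x, z⁆) y := by
  induction l with
  | nil => rfl
  | cons x l ih => rw [List.cons_append, nestedLie_cons x (by simp), ih, List.foldr_cons]

theorem map_nestedLie {L' : Type*} [LieRing L'] [LieAlgebra ℝ L'] (φ : L →ₗ⁅ℝ⁆ L')
    (l : List L) : φ (nestedLie l) = nestedLie (l.map φ) := by
  induction l with
  | nil => exact map_zero φ
  | cons x l ih =>
    by_cases hl : l = []
    · subst hl; rfl
    · rw [nestedLie_cons x hl, List.map_cons, nestedLie_cons _ (by simpa using hl), ← ih,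
        LieHom.map_lie]

omit [LieAlgebra ℝ L] in
theorem nestedLie_induction {motive : ℕ → L → Prop} {S : L → Prop} (zero : motive 0 0)
    (single : ∀ x, S x → motive 1 x)
    (lie : ∀ n x y, S x → motive n y → motive (n + 1) ⁅x, y⁆)
    (l : List L) (hl : ∀ x ∈ l, S x) : motive l.length (nestedLie l) := by
  induction l with
  | nil => exact zero
  | cons x l ih =>
    by_cases h : l = []
    · subst h
      exact single x (hl x (by simp))
    · rw [nestedLie_cons x h]
      exact lie _ _ _ (hl x (by simp)) (ih fun y hy => hl y (by simp [hy]))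

omit [LieRing L] [LieAlgebra ℝ L] in
theorem bchWord_cons (X Y : L) {k : ℕ} (a : ℕ × ℕ) (e : Fin k → ℕ × ℕ) :
    bchWord X Y (Fin.cons a e : Fin (k + 1) → ℕ × ℕ) =
      (List.replicate a.1 X ++ List.replicate a.2 Y) ++ bchWord X Y e := by
  simp [bchWord, List.ofFn_succ]

omit [LieRing L] [LieAlgebra ℝ L] in
theorem length_bchWord (X Y : L) {k : ℕ} (e : Fin k → ℕ × ℕ) :
    (bchWord X Y e).length = ∑ i, ((e i).1 + (e i).2) := by
  induction k with
  | zero => simp [bchWord]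
  | succ k ih =>
    rw [← Fin.cons_self_tail e, bchWord_cons, List.length_append, ih, Fin.sum_univ_succ]
    simp

omit [LieRing L] [LieAlgebra ℝ L] in
theorem mem_bchWord {X Y Z : L} {k : ℕ} {e : Fin k → ℕ × ℕ} (h : Z ∈ bchWord X Y e) :
    Z = X ∨ Z = Y := by
  simp only [bchWord, List.mem_flatten, List.mem_ofFn] at h
  obtain ⟨_, ⟨i, rfl⟩, h⟩ := h
  rcases List.mem_append.1 h with h | h
  · exact Or.inl (List.eq_of_mem_replicate h)
  · exact Or.inr (List.eq_of_mem_replicate h)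

omit [LieRing L] [LieAlgebra ℝ L] in
theorem map_bchWord {L' : Type*} (φ : L → L') (X Y : L) {k : ℕ}
    (e : Fin k → ℕ × ℕ) : (bchWord X Y e).map φ = bchWord (φ X) (φ Y) e := by
  simp [bchWord, List.map_flatten, List.map_ofFn, Function.comp_def]

theorem map_bchTerm {L' : Type*} [LieRing L'] [LieAlgebra ℝ L'] (φ : L →ₗ⁅ℝ⁆ L') (d : ℕ)
    (X Y : L) : φ (bchTerm d X Y) = bchTerm d (φ X) (φ Y) := by
  simp only [bchTerm, map_sum, map_smul, map_nestedLie, map_bchWord]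

/-- The sum of the terms of degree `< M` of the Baker–Campbell–Hausdorff series. -/
noncomputable def bchSum (M : ℕ) (X Y : L) : L := ∑ d ∈ Finset.range M, bchTerm d X Y

theorem map_bchSum {L' : Type*} [LieRing L'] [LieAlgebra ℝ L'] (φ : L →ₗ⁅ℝ⁆ L') (M : ℕ)
    (X Y : L) : φ (bchSum M X Y) = bchSum M (φ X) (φ Y) := by
  simp only [bchSum, map_sum, map_bchTerm]

/-- A subspace that contains the brackets of all words of length `d` in `X` and `Y` contains the
term of degree `d` of the Baker–Campbell–Hausdorff series. -/
theorem bchTerm_mem {X Y : L} {d : ℕ} (S : Submodule ℝ L)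
    (h : ∀ l : List L, l.length = d → (∀ Z ∈ l, Z = X ∨ Z = Y) → nestedLie l ∈ S) :
    bchTerm d X Y ∈ S := by
  refine Submodule.sum_mem _ fun k _ => Submodule.sum_mem _ fun e he =>
    Submodule.smul_mem _ _ (h _ ?_ fun Z hZ => mem_bchWord hZ)
  rw [length_bchWord]
  exact (Finset.mem_filter.1 he).2.2

theorem bchTerm_eq_zero {X Y : L} {d : ℕ}
    (h : ∀ l : List L, l.length = d → (∀ Z ∈ l, Z = X ∨ Z = Y) → nestedLie l = 0) :
    bchTerm d X Y = 0 :=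
  (Submodule.mem_bot ℝ).1 (bchTerm_mem ⊥ fun l hl hl' => (Submodule.mem_bot ℝ).2 (h l hl hl'))

/-- The pairs `(r, s) ≠ (0, 0)` with `r, s < M`. -/
def bchIndex (M : ℕ) : Finset (ℕ × ℕ) :=
  {a ∈ Finset.range M ×ˢ Finset.range M | 0 < a.1 + a.2}

/-- The weight `1 / (r! s!)` of a pair `(r, s)`. -/
noncomputable def bchWeight (a : ℕ × ℕ) : ℝ := ((a.1.factorial : ℝ) * (a.2.factorial : ℝ))⁻¹

theorem sum_piFinset_cons {α β : Type*} [AddCommMonoid β] [DecidableEq α] (T : Finset α) (k : ℕ)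
    (f : (Fin (k + 1) → α) → β) :
    ∑ e ∈ Fintype.piFinset (fun _ : Fin (k + 1) => T), f e =
      ∑ a ∈ T, ∑ e ∈ Fintype.piFinset (fun _ : Fin k => T), f (Fin.cons a e) := by
  rw [← Finset.sum_product']
  refine Finset.sum_bij' (fun e _ => (e 0, Fin.tail e)) (fun p _ => Fin.cons p.1 p.2) ?_ ?_ ?_ ?_ ?_
  · intro e he
    rw [Fintype.mem_piFinset] at he
    exact Finset.mem_product.2 ⟨he 0, Fintype.mem_piFinset.2 fun i => he i.succ⟩
  · intro p hp
    rw [Finset.mem_product, Fintype.mem_piFinset] at hp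
    rw [Fintype.mem_piFinset]
    intro i
    refine Fin.cases ?_ (fun j => ?_) i
    · exact hp.1
    · simpa using hp.2 j
  · intro e _
    exact Fin.cons_self_tail e
  · intro p _
    simp
  · intro e _
    rw [Fin.cons_self_tail]

/-- The operator `∑ (ad X)ʳ (ad Y)ˢ / (r! s!)`, the sum being over `(r, s) ≠ (0, 0)`. -/
noncomputable def bchOp (M : ℕ) (X Y : L) : Module.End ℝ L :=
  ∑ a ∈ bchIndex M, bchWeight a • (ad ℝ L X ^ a.1 * ad ℝ L Y ^ a.2)

/-- The element `∑ [Xʳ Yˢ] / (r! s!)`, the sum being over `(r, s) ≠ (0, 0)`. -/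
noncomputable def bchSeed (M : ℕ) (X Y : L) : L :=
  ∑ a ∈ bchIndex M, bchWeight a • nestedLie (List.replicate a.1 X ++ List.replicate a.2 Y)

/-- In a right-nested bracket the last block supplies the seed and each earlier block acts on it
through powers of `ad X` and `ad Y`. Summing over the blocks independently gives a power of one
operator. -/
theorem sum_nestedLie_bchWord (M k : ℕ) (X Y : L) :
    ∑ e ∈ Fintype.piFinset (fun _ : Fin (k + 1) => bchIndex M),
        (∏ i, bchWeight (e i)) • nestedLie (bchWord X Y e) =
      (bchOp M X Y ^ k) (bchSeed M X Y) := by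
  induction k with
  | zero =>
    rw [sum_piFinset_cons, pow_zero, bchSeed]
    refine Finset.sum_congr rfl fun a _ => ?_
    simp [bchWord]
  | succ k ih =>
    rw [sum_piFinset_cons, pow_succ', Module.End.mul_apply, ← ih, bchOp, LinearMap.sum_apply]
    refine Finset.sum_congr rfl fun a _ => ?_
    rw [LinearMap.smul_apply, map_sum, Finset.smul_sum]
    refine Finset.sum_congr rfl fun e he => ?_
    have hne : bchWord X Y e ≠ [] := by
      rw [← List.length_pos_iff, length_bchWord]
      have h0 := (Finset.mem_filter.1 (Fintype.mem_piFinset.1 he 0)).2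
      exact h0.trans_le (Finset.single_le_sum (f := fun i => (e i).1 + (e i).2)
        (fun i _ => Nat.zero_le _) (Finset.mem_univ 0))
    rw [bchWord_cons, List.append_assoc, nestedLie_replicate_append X _ (by simp [hne]),
      nestedLie_replicate_append Y _ hne, Fin.prod_univ_succ, map_smul, mul_smul]
    simp

/-- The `1` subtracted is the pair `(0, 0)`, which `bchIndex` leaves out; `0 < M` ensures that the
product contains it. -/
theorem bchOp_eq {M : ℕ} (hM : 0 < M) (X Y : L) :
    bchOp M X Y = PowerSeries.evalTrunc M (PowerSeries.exp ℝ) (ad ℝ L X) *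
      PowerSeries.evalTrunc M (PowerSeries.exp ℝ) (ad ℝ L Y) - 1 := by
  have h1 : PowerSeries.evalTrunc M (PowerSeries.exp ℝ) (ad ℝ L X) *
      PowerSeries.evalTrunc M (PowerSeries.exp ℝ) (ad ℝ L Y) =
      ∑ a ∈ Finset.range M ×ˢ Finset.range M,
        bchWeight a • (ad ℝ L X ^ a.1 * ad ℝ L Y ^ a.2) := by
    rw [PowerSeries.evalTrunc, PowerSeries.evalTrunc, Finset.sum_mul_sum, Finset.sum_product]
    refine Finset.sum_congr rfl fun i _ => Finset.sum_congr rfl fun j _ => ?_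
    rw [smul_mul_smul_comm, PowerSeries.coeff_exp_real, PowerSeries.coeff_exp_real, ← mul_inv]
    rfl
  rw [h1, bchOp, bchIndex, eq_sub_iff_add_eq,
    ← Finset.sum_filter_add_sum_filter_not (Finset.range M ×ˢ Finset.range M)
      (fun a => 0 < a.1 + a.2)]
  congr 1
  rw [Finset.sum_eq_single (0, 0)]
  · simp [bchWeight]
  · rintro ⟨a, b⟩ h h'
    simp at h
    exact absurd (Prod.ext h.2.1 h.2.2) h'
  · intro h
    exact absurd (by simpa using hM) h

/-- A word ending in two equal letters has bracket zero, so only the words `Xʳ Y` and the single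
letter `X` survive. -/
theorem nestedLie_replicate_append_replicate (X Y : L) (r s : ℕ) :
    nestedLie (List.replicate r X ++ List.replicate s Y) =
      (if s = 1 then (ad ℝ L X ^ r) Y else 0) + if r = 1 ∧ s = 0 then X else 0 := by
  rcases s with _ | _ | s
  · rcases r with _ | _ | r
    · simp [nestedLie]
    · simp [nestedLie]
    · have h : List.replicate (r + 1 + 1) X = List.replicate r X ++ [X, X] := by
        rw [List.replicate_succ', List.replicate_succ']
        simp
      rw [List.replicate_zero, List.append_nil, h, nestedLie_replicate_append X _ (by simp)]
      simp [nestedLie]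
  · rw [nestedLie_replicate_append X _ (by simp)]
    simp [nestedLie]
  · have h : List.replicate (s + 1 + 1) Y = List.replicate s Y ++ [Y, Y] := by
      rw [List.replicate_succ', List.replicate_succ']
      simp
    rw [nestedLie_replicate_append X _ (by simp), h, nestedLie_replicate_append Y _ (by simp)]
    simp [nestedLie]

theorem bchSeed_eq {M : ℕ} (hM : 2 ≤ M) (X Y : L) :
    bchSeed M X Y = X + PowerSeries.evalTrunc M (PowerSeries.exp ℝ) (ad ℝ L X) Y := by
  -- The pair `(0, 0)` may be added, because the empty word has bracket `0`.
  have h1 : bchSeed M X Y = ∑ a ∈ Finset.range M ×ˢ Finset.range M,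
      bchWeight a • nestedLie (List.replicate a.1 X ++ List.replicate a.2 Y) := by
    rw [bchSeed, bchIndex]
    apply Finset.sum_filter_of_ne
    rintro ⟨a, b⟩ _ h
    by_contra h'
    have ha : a = 0 := by simp at h'; exact h'.1
    have hb : b = 0 := by simp at h'; exact h'.2
    subst ha hb
    exact h (smul_zero _)
  rw [h1, add_comm]
  simp only [nestedLie_replicate_append_replicate, smul_add, Finset.sum_add_distrib]
  congr 1
  · rw [Finset.sum_product, PowerSeries.evalTrunc, LinearMap.sum_apply]
    refine Finset.sum_congr rfl fun r _ => ?_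
    rw [Finset.sum_eq_single 1]
    · simp [bchWeight]
    · intro s _ hs
      simp [hs]
    · intro h
      exact absurd (Finset.mem_range.2 hM) h
  · rw [Finset.sum_eq_single (1, 0)]
    · simp [bchWeight]
    · rintro ⟨r, s⟩ _ h
      rw [if_neg fun h' => h (Prod.ext h'.1 h'.2), smul_zero]
    · intro h
      exact absurd (by simp; omega) h

/-- The factor `d` cancels the `1/d` of Dynkin's coefficient. A word of length `d` in nonempty
blocks has at most `d` blocks with exponents at most `d`, so the ranges can be enlarged to a common
`M`; the number of blocks is now `k + 1`. -/
theorem smul_bchTerm (M d : ℕ) (hd : d < M) (X Y : L) :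
    (d : ℝ) • bchTerm d X Y = ∑ k ∈ Finset.range M, ((-1 : ℝ) ^ k / (k + 1)) •
      ∑ e ∈ Fintype.piFinset (fun _ : Fin (k + 1) => bchIndex M) with
        ∑ i, ((e i).1 + (e i).2) = d, (∏ i, bchWeight (e i)) • nestedLie (bchWord X Y e) := by
  have hset : ∀ k : ℕ, ({e ∈ Fintype.piFinset fun _ : Fin k =>
        Finset.range (d + 1) ×ˢ Finset.range (d + 1) |
        (∀ i, 0 < (e i).1 + (e i).2) ∧ ∑ i, ((e i).1 + (e i).2) = d} : Finset _) =
      {e ∈ Fintype.piFinset (fun _ : Fin k => bchIndex M) | ∑ i, ((e i).1 + (e i).2) = d} := by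
    intro k
    ext e
    simp only [Finset.mem_filter, Fintype.mem_piFinset, bchIndex, Finset.mem_product,
      Finset.mem_range]
    constructor
    · rintro ⟨h1, h2, h3⟩
      refine ⟨fun i => ⟨⟨?_, ?_⟩, h2 i⟩, h3⟩ <;> have := h1 i <;> omega
    · rintro ⟨h1, h3⟩
      refine ⟨fun i => ?_, fun i => (h1 i).2, h3⟩
      have := Finset.single_le_sum (f := fun i => (e i).1 + (e i).2)
        (fun i _ => Nat.zero_le _) (Finset.mem_univ i)
      simp only [h3] at this
      omega
  have hlarge : ∀ k ∈ Finset.range M, k ∉ Finset.range d → ((-1 : ℝ) ^ k / (k + 1)) •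
      ∑ e ∈ Fintype.piFinset (fun _ : Fin (k + 1) => bchIndex M) with
        ∑ i, ((e i).1 + (e i).2) = d, (∏ i, bchWeight (e i)) • nestedLie (bchWord X Y e) =
        0 := by
    intro k _ hk
    rw [Finset.sum_eq_zero, smul_zero]
    intro e he
    exfalso
    rw [Finset.mem_filter, Fintype.mem_piFinset] at he
    have h1 : ∑ i : Fin (k + 1), 1 ≤ ∑ i, ((e i).1 + (e i).2) :=
      Finset.sum_le_sum fun i _ => (Finset.mem_filter.1 (he.1 i)).2
    rw [he.2] at h1
    simp at h1 hk
    omega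
  rw [← Finset.sum_subset (Finset.range_subset_range.2 hd.le) hlarge, bchTerm, Finset.smul_sum]
  refine Finset.sum_nbij' (· - 1) (· + 1) ?_ ?_ ?_ ?_ ?_
  · intro k hk
    simp only [Finset.mem_Icc, Finset.mem_range] at hk ⊢
    omega
  · intro k hk
    simp only [Finset.mem_Icc, Finset.mem_range] at hk ⊢
    omega
  · intro k hk
    simp only [Finset.mem_Icc] at hk
    omega
  · intro k _
    rfl
  · intro k hk
    rw [Finset.mem_Icc] at hk
    obtain ⟨k, rfl⟩ := Nat.exists_eq_add_of_le' hk.1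
    rw [Finset.smul_sum, hset, Nat.add_sub_cancel, Finset.smul_sum]
    refine Finset.sum_congr rfl fun e _ => ?_
    rw [smul_smul, smul_smul]
    congr 1
    have hd0 : (d : ℝ) ≠ 0 := by
      have : d ≠ 0 := by omega
      exact_mod_cast this
    simp only [bchWeight, Finset.prod_inv_distrib]
    push_cast
    have hk0 : (k : ℝ) + 1 ≠ 0 := by positivity
    have hP : ∏ i, (((e i).1.factorial : ℝ) * ((e i).2.factorial : ℝ)) ≠ 0 :=
      Finset.prod_ne_zero_iff.2 fun i _ => by positivity
    field_simp

/-- Summing over `d < M` leaves only the constraint that words be shorter than `M`, and longer words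
vanish. The free sum over blocks is then the series `∑ (-1)ᵏ/(k+1) uᵏ` in `u = bchOp`, applied to
the seed. -/
theorem sum_smul_bchTerm {M : ℕ} {X Y : L}
    (h : ∀ l : List L, M ≤ l.length → (∀ Z ∈ l, Z = X ∨ Z = Y) → nestedLie l = 0) :
    ∑ d ∈ Finset.range M, (d : ℝ) • bchTerm d X Y =
      PowerSeries.evalTrunc M PowerSeries.logQuot (bchOp M X Y) (bchSeed M X Y) := by
  rw [Finset.sum_congr rfl fun d hd => smul_bchTerm M d (Finset.mem_range.1 hd) X Y,
    Finset.sum_comm, PowerSeries.evalTrunc, LinearMap.sum_apply]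
  refine Finset.sum_congr rfl fun k _ => ?_
  rw [← Finset.smul_sum, Finset.sum_fiberwise_eq_sum_filter, LinearMap.smul_apply,
    ← sum_nestedLie_bchWord, PowerSeries.logQuot, PowerSeries.coeff_mk]
  congr 1
  apply Finset.sum_filter_of_ne
  intro e _ hne
  by_contra hlt
  refine hne ?_
  rw [h _ _ fun Z hZ => mem_bchWord hZ, smul_zero]
  rw [length_bchWord]
  simpa using hlt

end Words

/-! ### The Baker–Campbell–Hausdorff formula in an associative algebra -/

section Assoc

open PowerSeries LieAlgebra

attribute [local instance] LieRing.ofAssociativeRing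

variable {R : Type*} [Ring R] [Algebra ℝ R]

theorem evalTrunc_mulLeft (M : ℕ) (f : ℝ⟦X⟧) (a w : R) :
    evalTrunc M f (LinearMap.mulLeft ℝ a) w = evalTrunc M f a * w := by
  simp only [evalTrunc, LinearMap.sum_apply, LinearMap.smul_apply, LinearMap.pow_mulLeft,
    LinearMap.mulLeft_apply, Finset.sum_mul, smul_mul_assoc]

theorem evalTrunc_mulRight (M : ℕ) (f : ℝ⟦X⟧) (a w : R) :
    evalTrunc M f (LinearMap.mulRight ℝ a) w = w * evalTrunc M f a := by
  simp only [evalTrunc, LinearMap.sum_apply, LinearMap.smul_apply, LinearMap.pow_mulRight,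
    LinearMap.mulRight_apply, Finset.mul_sum, mul_smul_comm]

theorem mulLeft_pow_eq_zero {m : ℕ} {a : R} (ha : a ^ m = 0) : LinearMap.mulLeft ℝ a ^ m = 0 := by
  rw [LinearMap.pow_mulLeft, ha, LinearMap.mulLeft_zero_eq_zero]

theorem mulRight_pow_eq_zero {m : ℕ} {a : R} (ha : a ^ m = 0) :
    LinearMap.mulRight ℝ a ^ m = 0 := by
  rw [LinearMap.pow_mulRight, ha, LinearMap.mulRight_zero_eq_zero]

theorem ad_add_mulRight (a : R) :
    ad ℝ R a + LinearMap.mulRight ℝ a = LinearMap.mulLeft ℝ a := by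
  ext w
  simp [LieRing.of_associative_ring_bracket]

theorem commute_ad_mulRight (a : R) : Commute (ad ℝ R a) (LinearMap.mulRight ℝ a) := by
  rw [← sub_eq_iff_eq_add.2 (ad_add_mulRight a).symm]
  exact (LinearMap.commute_mulLeft_right a a).sub_left (Commute.refl _)

theorem ad_eq_mulLeft_add_mulRight_neg (a : R) :
    ad ℝ R a = LinearMap.mulLeft ℝ a + LinearMap.mulRight ℝ (-a) := by
  ext w
  simp [LieRing.of_associative_ring_bracket, sub_eq_add_neg]

theorem ad_pow_eq_zero {m : ℕ} {a : R} (ha : a ^ m = 0) : ad ℝ R a ^ (2 * m) = 0 := by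
  rw [ad_eq_mulLeft_add_mulRight_neg]
  exact Commute.add_pow_eq_zero_of_add_le_succ_of_pow_eq_zero
    (LinearMap.commute_mulLeft_right a (-a)) (mulLeft_pow_eq_zero ha)
    (mulRight_pow_eq_zero (by rw [neg_pow, ha, mul_zero])) (by omega)

/-- `ad a` is the sum of two commuting operators, left multiplication by `a` and right
multiplication by `-a`, so its exponential is the product of theirs. The bound `2 * m` is the
nilpotency order of such a sum. -/
theorem evalTrunc_exp_ad {m M : ℕ} {a : R} (ha : a ^ m = 0) (hM : 2 * m ≤ M) (w : R) :
    evalTrunc M (exp ℝ) (ad ℝ R a) w =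
      evalTrunc M (exp ℝ) a * w * evalTrunc M (exp ℝ) (-a) := by
  have ha' : (-a) ^ m = 0 := by rw [neg_pow, ha, mul_zero]
  rw [evalTrunc_eq_of_le (ad_pow_eq_zero ha) hM, evalTrunc_eq_of_le ha (by omega : m ≤ M),
    evalTrunc_eq_of_le ha' (by omega : m ≤ M)]
  rw [ad_eq_mulLeft_add_mulRight_neg,
    evalTrunc_exp_add (LinearMap.commute_mulLeft_right a (-a)) (mulLeft_pow_eq_zero ha)
    (mulRight_pow_eq_zero ha'), Module.End.mul_apply, evalTrunc_mulRight, evalTrunc_mulLeft,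
    mul_assoc]

theorem map_pow_of_leibniz (D : R →ₗ[ℝ] R) (hD : ∀ a b, D (a * b) = D a * b + a * D b) (z : R)
    (n : ℕ) : D (z ^ (n + 1)) =
      ∑ p ∈ Finset.HasAntidiagonal.antidiagonal n, z ^ p.1 * D z * z ^ p.2 := by
  induction n with
  | zero => simp
  | succ n ih =>
    rw [pow_succ, hD, ih, Finset.Nat.antidiagonal_succ', Finset.sum_cons, Finset.sum_map,
      Finset.sum_mul, add_comm]
    congr 1
    · simp
    · refine Finset.sum_congr rfl fun p _ => ?_
      simp only [Function.Embedding.prodMap, Function.Embedding.coeFn_mk, Prod.map,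
          Function.Embedding.refl_apply]
      rw [mul_assoc, ← pow_succ]

/-- The derivative of the exponential map. -/
theorem map_exp_of_leibniz (D : R →ₗ[ℝ] R) (hD : ∀ a b, D (a * b) = D a * b + a * D b) {m M : ℕ}
    {z : R} (hz : z ^ m = 0) (hM : 2 * m ≤ M) :
    D (evalTrunc M (exp ℝ) z) =
      evalTrunc M expQuot (ad ℝ R z) (D z) * evalTrunc M (exp ℝ) z := by
  have hzM : z ^ M = 0 := pow_eq_zero_of_le (by omega) hz
  have hadM : ad ℝ R z ^ M = 0 := pow_eq_zero_of_le hM (ad_pow_eq_zero hz)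
  have h1 : D 1 = 0 := by simpa using hD 1 1
  -- The sum of `ad z` and right multiplication by `z` is left multiplication, so at `D z` the
  -- operator identity produces the terms `zⁱ (D z) zʲ` of the derivative of a power of `z`.
  have h := congrArg (fun φ : Module.End ℝ R => φ (D z))
    (evalTrunc_expQuot_mul_exp (commute_ad_mulRight z) hadM (mulRight_pow_eq_zero hzM))
  have hcomm : Commute (evalTrunc M expQuot (ad ℝ R z))
      (evalTrunc M (exp ℝ) (LinearMap.mulRight ℝ z)) :=
    Commute.sum_left _ _ _ fun i _ => Commute.sum_right _ _ _ fun j _ =>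
      (((commute_ad_mulRight z).pow_pow i j).smul_left _).smul_right _
  simp only [hcomm.eq, Module.End.mul_apply, evalTrunc_mulRight] at h
  -- With truncation at `2 * M + 1`, splitting off the constant term, which `D` kills, leaves a sum
  -- over `n < 2 * M`, as in `h`.
  rw [h, ← evalTrunc_eq_of_le hzM (by omega : M ≤ 2 * M + 1), evalTrunc, Finset.sum_range_succ',
    map_add, pow_zero, map_smul, h1, smul_zero, add_zero, map_sum, LinearMap.sum_apply]
  refine Finset.sum_congr rfl fun n _ => ?_
  rw [map_smul, map_pow_of_leibniz D hD, LinearMap.smul_apply, coeff_exp_real,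
    LinearMap.sum_apply]
  congr 1
  refine Finset.sum_congr rfl fun p _ => ?_
  rw [ad_add_mulRight, Module.End.mul_apply, LinearMap.pow_mulRight, LinearMap.pow_mulLeft,
    LinearMap.mulRight_apply, LinearMap.mulLeft_apply, mul_assoc]

variable (R) in
/-- A decreasing multiplicative filtration of an algebra that vanishes in degree `N`. -/
structure NilFiltration (N : ℕ) where
  part : ℕ → Submodule ℝ R
  antitone : Antitone part
  mul_mem : ∀ {i j : ℕ} {a b : R}, a ∈ part i → b ∈ part j → a * b ∈ part (i + j)
  eq_zero : ∀ {a : R}, a ∈ part N → a = 0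

namespace NilFiltration

variable {N : ℕ} (F : NilFiltration R N)

/-- Exponents start at `1` because `1` need not lie in `part 0`; hence the `N + 1` in `pow_eq_zero`,
which also covers `N = 0`. -/
theorem pow_mem {a : R} (ha : a ∈ F.part 1) (n : ℕ) : a ^ (n + 1) ∈ F.part (n + 1) := by
  induction n with
  | zero => simpa using ha
  | succ n ih => rw [pow_succ]; exact F.mul_mem ih ha

theorem eq_zero_of_le {a : R} {n : ℕ} (hn : N ≤ n) (ha : a ∈ F.part n) : a = 0 :=
  F.eq_zero (F.antitone hn ha)

theorem pow_eq_zero {a : R} (ha : a ∈ F.part 1) : a ^ (N + 1) = 0 :=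
  F.eq_zero_of_le (Nat.le_succ N) (F.pow_mem ha N)

theorem evalTrunc_mem {a : R} (ha : a ∈ F.part 1) (M : ℕ) {f : ℝ⟦X⟧} (hf : constantCoeff f = 0) :
    evalTrunc M f a ∈ F.part 1 := by
  refine Submodule.sum_mem _ fun i _ => ?_
  cases i with
  | zero => simp [hf]
  | succ i => exact Submodule.smul_mem _ _ (F.antitone (Nat.le_add_left 1 i) (F.pow_mem ha i))

theorem exp_mul_exp_sub_one_mem {x y : R} (hx : x ∈ F.part 1) (hy : y ∈ F.part 1) {M : ℕ}
    (hM : N + 1 ≤ M) : evalTrunc M (exp ℝ) x * evalTrunc M (exp ℝ) y - 1 ∈ F.part 1 := by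
  have h : ∀ z ∈ F.part 1, evalTrunc M (exp ℝ) z - 1 ∈ F.part 1 := fun z hz => by
    rw [← evalTrunc_one (pow_eq_zero_of_le hM (F.pow_eq_zero hz)), ← evalTrunc_sub]
    exact F.evalTrunc_mem hz M (by simp [constantCoeff_exp])
  have e : evalTrunc M (exp ℝ) x * evalTrunc M (exp ℝ) y - 1 =
      (evalTrunc M (exp ℝ) x - 1) * (evalTrunc M (exp ℝ) y - 1) +
        (evalTrunc M (exp ℝ) x - 1) + (evalTrunc M (exp ℝ) y - 1) := by noncomm_ring
  rw [e]
  exact Submodule.add_mem _ (Submodule.add_mem _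
    (F.antitone one_le_two (F.mul_mem (h x hx) (h y hy))) (h x hx)) (h y hy)

theorem nestedLie_mem (l : List R) (hl : ∀ x ∈ l, x ∈ F.part 1) :
    nestedLie l ∈ F.part l.length := by
  refine nestedLie_induction (motive := fun n a => a ∈ F.part n) (S := fun a => a ∈ F.part 1)
    (Submodule.zero_mem _) (fun x hx => hx) (fun n x y hx hy => ?_) l hl
  rw [LieRing.of_associative_ring_bracket]
  refine Submodule.sub_mem _ ?_ (F.mul_mem hy hx)
  rw [add_comm]
  exact F.mul_mem hx hy

theorem bchTerm_mem {x y : R} (hx : x ∈ F.part 1) (hy : y ∈ F.part 1) (d : ℕ) :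
    bchTerm d x y ∈ F.part d :=
  _root_.bchTerm_mem _ fun l hl hl' => hl ▸ F.nestedLie_mem l fun z hz => by
    rcases hl' z hz with rfl | rfl
    exacts [hx, hy]

theorem bchSum_mem {x y : R} (hx : x ∈ F.part 1) (hy : y ∈ F.part 1) (M : ℕ) :
    bchSum M x y ∈ F.part 1 := by
  refine Submodule.sum_mem _ fun d _ => ?_
  cases d with
  | zero => simp [bchTerm]
  | succ d => exact F.antitone (Nat.le_add_left 1 d) (F.bchTerm_mem hx hy (d + 1))

end NilFiltration

/-- A derivation of the product is one of the commutator, so eigenvalues add under brackets and `D`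
counts letters. -/
theorem map_nestedLie_of_leibniz (D : R →ₗ[ℝ] R) (hD : ∀ a b, D (a * b) = D a * b + a * D b)
    (l : List R) (hl : ∀ x ∈ l, D x = x) : D (nestedLie l) = (l.length : ℝ) • nestedLie l := by
  refine nestedLie_induction (motive := fun n a => D a = (n : ℝ) • a) (S := fun a => D a = a)
    (by simp) (fun x hx => by simp [hx]) (fun n x y hx hy => ?_) l hl
  rw [LieRing.of_associative_ring_bracket, map_sub, hD, hD, hx, hy]
  push_cast
  simp only [mul_smul_comm, smul_mul_assoc, add_smul, smul_sub, one_smul]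
  abel

theorem map_bchTerm_of_leibniz (D : R →ₗ[ℝ] R) (hD : ∀ a b, D (a * b) = D a * b + a * D b)
    {x y : R} (hx : D x = x) (hy : D y = y) (d : ℕ) :
    D (bchTerm d x y) = (d : ℝ) • bchTerm d x y := by
  have h : bchTerm d x y ∈ LinearMap.ker (D - (d : ℝ) • LinearMap.id) :=
    bchTerm_mem _ fun l hl hl' => by
      rw [LinearMap.mem_ker, LinearMap.sub_apply, map_nestedLie_of_leibniz D hD l, hl]
      · exact sub_self _
      · intro z hz
        rcases hl' z hz with rfl | rfl
        exacts [hx, hy]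
  exact sub_eq_zero.1 h

/-- Dynkin's formula for elements on which an injective derivation acts as the identity. -/
theorem NilFiltration.exp_bchSum_of_leibniz {N : ℕ} (F : NilFiltration R N) (D : R →ₗ[ℝ] R)
    (hD : ∀ a b, D (a * b) = D a * b + a * D b) (hinj : ∀ a ∈ F.part 1, D a = 0 → a = 0)
    {x y : R} (hxF : x ∈ F.part 1) (hyF : y ∈ F.part 1) (hx : D x = x) (hy : D y = y) {M : ℕ}
    (hM : 2 * (N + 1) ≤ M) :
    evalTrunc M (exp ℝ) (bchSum M x y) = evalTrunc M (exp ℝ) x * evalTrunc M (exp ℝ) y := by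
  have hle : N + 1 ≤ M := by omega
  set u := evalTrunc M (exp ℝ) x * evalTrunc M (exp ℝ) y - 1 with hu
  have huF : u ∈ F.part 1 := F.exp_mul_exp_sub_one_mem hxF hyF hle
  -- The true logarithm of the product; it will be identified with `bchSum M x y` by comparing
  -- images under `D`.
  set z := evalTrunc M (log ℝ) u with hz
  have hzF : z ∈ F.part 1 := F.evalTrunc_mem huF M constantCoeff_log
  have hpow : ∀ a ∈ F.part 1, a ^ M = 0 := fun a ha => pow_eq_zero_of_le hle (F.pow_eq_zero ha)
  have hexpz : evalTrunc M (exp ℝ) z = evalTrunc M (exp ℝ) x * evalTrunc M (exp ℝ) y := by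
    rw [hz, evalTrunc_exp_log (hpow u huF), hu, add_sub_cancel]
  -- The exponential of `ad` is a conjugation, and conjugating by `exp z = exp x * exp y` is the
  -- composite of the two conjugations.
  have hadz : evalTrunc M (exp ℝ) (ad ℝ R z) =
      evalTrunc M (exp ℝ) (ad ℝ R x) * evalTrunc M (exp ℝ) (ad ℝ R y) := by
    have hinv : evalTrunc M (exp ℝ) (-z) =
        evalTrunc M (exp ℝ) (-y) * evalTrunc M (exp ℝ) (-x) := by
      have h1 := evalTrunc_exp_mul_exp_neg (hpow x hxF)
      have h2 := evalTrunc_exp_mul_exp_neg (hpow y hyF)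
      have h3 := evalTrunc_exp_mul_exp_neg (hpow (-z) (Submodule.neg_mem _ hzF))
      rw [neg_neg, hexpz] at h3
      refine left_inv_eq_right_inv h3 ?_
      rw [mul_assoc, ← mul_assoc _ (evalTrunc M (exp ℝ) (-y)), h2, one_mul, h1]
    ext w
    rw [Module.End.mul_apply, evalTrunc_exp_ad (F.pow_eq_zero hzF) hM,
      evalTrunc_exp_ad (F.pow_eq_zero hxF) hM, evalTrunc_exp_ad (F.pow_eq_zero hyF) hM, hexpz, hinv]
    simp only [mul_assoc]
  -- Here `ad a` kills `D a = a`, so only the constant term `1` of `expQuot` contributes.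
  have hself : ∀ a ∈ F.part 1, D a = a →
      D (evalTrunc M (exp ℝ) a) = a * evalTrunc M (exp ℝ) a := by
    intro a ha hDa
    rw [map_exp_of_leibniz D hD (F.pow_eq_zero ha) hM, hDa]
    congr 1
    obtain ⟨M, rfl⟩ : ∃ M', M = M' + 1 := ⟨M - 1, by omega⟩
    rw [evalTrunc, LinearMap.sum_apply, Finset.sum_range_succ', Finset.sum_eq_zero]
    · simp [expQuot]
    · intro i _
      rw [LinearMap.smul_apply, pow_succ, Module.End.mul_apply, ad_apply, lie_self, map_zero,
        smul_zero]
  -- Compute `D (exp z) * exp (-z)` in two ways: by the derivative of the exponential at `z`, and by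
  -- Leibniz on `exp x * exp y`, which gives `x + e^x y e^{-x}`.
  have hDz : evalTrunc M expQuot (ad ℝ R z) (D z) = bchSeed M x y := by
    have h1 := map_exp_of_leibniz D hD (F.pow_eq_zero hzF) hM
    rw [hexpz, hD, hself x hxF hx, hself y hyF hy] at h1
    have h2 := congrArg (· * evalTrunc M (exp ℝ) (-z)) h1
    have h3 := evalTrunc_exp_mul_exp_neg (hpow z hzF)
    have h4 := evalTrunc_exp_mul_exp_neg (hpow (-x) (Submodule.neg_mem _ hxF))
    have h5 : evalTrunc M (exp ℝ) y * evalTrunc M (exp ℝ) (-z) = evalTrunc M (exp ℝ) (-x) := by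
      rw [neg_neg] at h4
      rw [hexpz] at h3
      calc _ = (evalTrunc M (exp ℝ) (-x) * evalTrunc M (exp ℝ) x) *
          (evalTrunc M (exp ℝ) y * evalTrunc M (exp ℝ) (-z)) := by rw [h4, one_mul]
        _ = evalTrunc M (exp ℝ) (-x) * ((evalTrunc M (exp ℝ) x * evalTrunc M (exp ℝ) y) *
            evalTrunc M (exp ℝ) (-z)) := by simp only [mul_assoc]
        _ = _ := by rw [h3, mul_one]
    rw [hexpz] at h3
    rw [mul_assoc _ _ (evalTrunc M (exp ℝ) (-z)), h3, mul_one] at h2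
    rw [← h2, bchSeed_eq (by omega), evalTrunc_exp_ad (F.pow_eq_zero hxF) hM, add_mul]
    congr 1
    · rw [mul_assoc, mul_assoc, ← mul_assoc (evalTrunc M (exp ℝ) x), h3, mul_one]
    · rw [← h5]
      simp only [mul_assoc]
  have hnest : ∀ l : List R, M ≤ l.length → (∀ Z ∈ l, Z = x ∨ Z = y) → nestedLie l = 0 :=
    fun l hl hl' => F.eq_zero_of_le (by omega) (F.nestedLie_mem l fun a ha => by
      rcases hl' a ha with rfl | rfl
      exacts [hxF, hyF])
  -- Since `bchOp` equals `e^{ad z} - 1`, applying `logQuot` of it to `hDz` undoes `expQuot (ad z)`.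
  have hfin : D z = D (bchSum M x y) := by
    rw [bchSum, map_sum, Finset.sum_congr rfl fun d _ => map_bchTerm_of_leibniz D hD hx hy d,
      sum_smul_bchTerm hnest, ← hDz, bchOp_eq (by omega), ← hadz, ← Module.End.mul_apply,
      evalTrunc_logQuot_mul_expQuot
        (pow_eq_zero_of_le hM (ad_pow_eq_zero (F.pow_eq_zero hzF))), Module.End.one_apply]
  have hzeq : z = bchSum M x y := sub_eq_zero.1 (hinj _
    (Submodule.sub_mem _ hzF (F.bchSum_mem hxF hyF M)) (by rw [map_sub, hfin, sub_self]))
  rw [← hzeq, hexpz]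

end Assoc

/-! ### Removing the derivation by passing to polynomials -/

section Assoc

open PowerSeries LieAlgebra

attribute [local instance] LieRing.ofAssociativeRing

variable {B : Type*} [Ring B] [Algebra ℝ B]

namespace NilFiltration

variable {N : ℕ}

/-- The filtration of `B[t]` by the polynomials divisible by `tⁱ` with coefficients in degree `i`. -/
def polynomial (F : NilFiltration B N) : NilFiltration (Polynomial B) N where
  part i :=
    { carrier := {f | ∀ n, f.coeff n ∈ F.part i ∧ (n < i → f.coeff n = 0)}
      add_mem' := fun {f g} hf hg n => ⟨by
        rw [Polynomial.coeff_add]; exact Submodule.add_mem _ (hf n).1 (hg n).1, fun h => by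
        rw [Polynomial.coeff_add, (hf n).2 h, (hg n).2 h, add_zero]⟩
      zero_mem' := fun n => ⟨by simp, fun _ => by simp⟩
      smul_mem' := fun c f hf n => ⟨by
        rw [Polynomial.coeff_smul]; exact Submodule.smul_mem _ _ (hf n).1, fun h => by
        rw [Polynomial.coeff_smul, (hf n).2 h, smul_zero]⟩ }
  antitone i j hij f hf n := ⟨F.antitone hij (hf n).1, fun h => (hf n).2 (h.trans_le hij)⟩
  mul_mem {i j f g} hf hg n := by
    rw [Polynomial.coeff_mul]
    refine ⟨Submodule.sum_mem _ fun p _ => F.mul_mem (hf p.1).1 (hg p.2).1, fun h =>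
      Finset.sum_eq_zero fun p hp => ?_⟩
    have hp' := Finset.HasAntidiagonal.mem_antidiagonal.1 hp
    rcases lt_or_ge p.1 i with h1 | h1
    · rw [(hf p.1).2 h1, zero_mul]
    · rw [(hg p.2).2 (by omega), mul_zero]
  eq_zero {f} hf := Polynomial.ext fun n => by
    rw [Polynomial.coeff_zero]
    exact F.eq_zero (hf n).1

theorem X_mul_C_mem (F : NilFiltration B N) {x : B} (hx : x ∈ F.part 1) :
    Polynomial.X * Polynomial.C x ∈ F.polynomial.part 1 := by
  intro n
  cases n with
  | zero => simp
  | succ n =>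
    rw [Polynomial.coeff_X_mul, Polynomial.coeff_C]
    refine ⟨?_, fun h => absurd h (by omega)⟩
    split_ifs
    exacts [hx, Submodule.zero_mem _]

end NilFiltration

/-- The Euler derivation `t d/dt` of `B[t]`. -/
noncomputable def eulerDerivation : Polynomial B →ₗ[ℝ] Polynomial B where
  toFun f := Polynomial.X * Polynomial.derivative f
  map_add' f g := by rw [map_add, mul_add]
  map_smul' c f := by rw [Polynomial.derivative_smul, mul_smul_comm, RingHom.id_apply]

/-- The evaluation of polynomials at `1`. -/
noncomputable def evalOne : Polynomial B →ₐ[ℝ] B :=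
  { Polynomial.eval₂RingHom' (RingHom.id B) 1 (fun a => Commute.one_right a) with
    commutes' := fun r => by
      change Polynomial.eval₂ (RingHom.id B) 1 (algebraMap ℝ (Polynomial B) r) = _
      rw [Polynomial.algebraMap_apply, Polynomial.eval₂_C, RingHom.id_apply] }

theorem evalOne_X_mul_C (x : B) : evalOne (Polynomial.X * Polynomial.C x) = x := by
  rw [map_mul]
  change Polynomial.eval₂ _ _ _ * Polynomial.eval₂ _ _ _ = _
  rw [Polynomial.eval₂_X, Polynomial.eval₂_C, one_mul, RingHom.id_apply]

/-- The Baker–Campbell–Hausdorff formula, in Dynkin's form, for elements of a nilpotent associative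
algebra. -/
theorem NilFiltration.exp_bchSum {N : ℕ} (F : NilFiltration B N) {x y : B} (hx : x ∈ F.part 1)
    (hy : y ∈ F.part 1) {M : ℕ} (hM : 2 * (N + 1) ≤ M) :
    evalTrunc M (exp ℝ) (bchSum M x y) = evalTrunc M (exp ℝ) x * evalTrunc M (exp ℝ) y := by
  have hself : ∀ z : B, eulerDerivation (Polynomial.X * Polynomial.C z) =
      Polynomial.X * Polynomial.C z := fun z => by
    simp [eulerDerivation]
  have h := F.polynomial.exp_bchSum_of_leibniz eulerDerivation
    (fun a b => by
      simp only [eulerDerivation, LinearMap.coe_mk, AddHom.coe_mk, Polynomial.derivative_mul,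
        mul_add, mul_assoc]
      rw [← mul_assoc a, ← Polynomial.X_mul (p := a), mul_assoc])
    -- The constant coefficient vanishes by the definition of the filtration, and `t d/dt`
    -- multiplies the coefficient of degree `n + 1` by `n + 1`.
    (fun a ha h => by
      ext n
      rw [Polynomial.coeff_zero]
      cases n with
      | zero => exact (ha 0).2 one_pos
      | succ n =>
        have h1 := congrArg (fun f : Polynomial B => f.coeff (n + 1)) h
        simp only [eulerDerivation, LinearMap.coe_mk, AddHom.coe_mk, Polynomial.coeff_X_mul,
          Polynomial.coeff_derivative, Polynomial.coeff_zero] at h1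
        have h2 : ((n : ℝ) + 1) • a.coeff (n + 1) = 0 := by
          rw [← h1, Algebra.smul_def, Algebra.commutes]
          simp
        exact (smul_eq_zero.1 h2).resolve_left (by positivity))
    (F.X_mul_C_mem hx) (F.X_mul_C_mem hy) (hself x) (hself y) hM
  -- Setting `t = 1` returns from `tx`, `ty` to `x`, `y`.
  have h' := congrArg evalOne h
  rw [map_mul, map_evalTrunc, map_evalTrunc, map_evalTrunc, evalOne_X_mul_C, evalOne_X_mul_C] at h'
  rw [← h', ← AlgHom.coe_toLieHom, map_bchSum, AlgHom.coe_toLieHom, evalOne_X_mul_C,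
    evalOne_X_mul_C]

end Assoc

/-! ### The affine representation of a nilpotent Lie algebra -/

section Affine

open LieAlgebra

attribute [local instance] LieRing.ofAssociativeRing

variable {L : Type*} [LieRing L] [LieAlgebra ℝ L]

theorem lowerCentralSeries_le_span_foldr (i : ℕ) :
    (LieModule.lowerCentralSeries ℝ L L i).toSubmodule ≤
      Submodule.span ℝ {z : L | ∃ (l : List L) (y : L), l.length = i ∧
        l.foldr (fun a b => ⁅a, b⁆) y = z} := by
  induction i with
  | zero => exact fun z _ => Submodule.subset_span ⟨[], z, rfl, rfl⟩
  | succ i ih =>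
    rw [LieModule.lowerCentralSeries_succ, LieSubmodule.lieIdeal_oper_eq_linear_span,
      Submodule.span_le]
    rintro _ ⟨x, z, rfl⟩
    have hz := ih z.2
    change ⁅(x : L), (z : L)⁆ ∈ _
    generalize (z : L) = z at hz
    induction hz using Submodule.span_induction with
    | mem z hz =>
      obtain ⟨l, y, hl, rfl⟩ := hz
      exact Submodule.subset_span ⟨(x : L) :: l, y, by rw [List.length_cons, hl], rfl⟩
    | zero => rw [lie_zero]; exact Submodule.zero_mem _
    | add a b _ _ ha hb => rw [lie_add]; exact Submodule.add_mem _ ha hb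
    | smul r a _ ha => rw [lie_smul]; exact Submodule.smul_mem _ r ha

theorem lowerCentralSeries_eq_bot_of_foldr {k : ℕ}
    (h : ∀ (l : List L) (y : L), l.length = k → l.foldr (fun a b => ⁅a, b⁆) y = 0) :
    LieModule.lowerCentralSeries ℝ L L k = ⊥ := by
  rw [← LieSubmodule.toSubmodule_eq_bot, eq_bot_iff]
  refine (lowerCentralSeries_le_span_foldr k).trans (Submodule.span_le.2 ?_)
  rintro _ ⟨l, y, hl, rfl⟩
  exact h l y hl

/-- The affine operator `(v, s) ↦ ([a, v] + s b, 0)`. -/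
noncomputable def affineOp (a b : L) : Module.End ℝ (L × ℝ) where
  toFun v := (⁅a, v.1⁆ + v.2 • b, 0)
  map_add' v w := by
    ext
    · simp only [Prod.fst_add, Prod.snd_add, lie_add, add_smul]; abel
    · simp
  map_smul' r v := by
    ext
    · simp [mul_smul]
    · simp

theorem affineOp_apply (a b : L) (v : L × ℝ) : affineOp a b v = (⁅a, v.1⁆ + v.2 • b, 0) := rfl

theorem affineOp_add (a b a' b' : L) :
    affineOp (a + a') (b + b') = affineOp a b + affineOp a' b' := by
  refine LinearMap.ext fun v => Prod.ext ?_ ?_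
  · simp only [affineOp_apply, LinearMap.add_apply, Prod.fst_add, add_lie, smul_add]; abel
  · simp [affineOp_apply]

theorem affineOp_smul (r : ℝ) (a b : L) : affineOp (r • a) (r • b) = r • affineOp a b := by
  refine LinearMap.ext fun v => Prod.ext ?_ ?_
  · simp [affineOp_apply, smul_comm r]
  · simp [affineOp_apply]

/-- The pair `(a, b)` stands for the value and the velocity of a curve: the second entry of the
bracket follows the Leibniz rule. -/
theorem affineOp_lie (a b a' b' : L) :
    affineOp ⁅a, a'⁆ (⁅a, b'⁆ + ⁅b, a'⁆) = ⁅affineOp a b, affineOp a' b'⁆ := by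
  rw [LieRing.of_associative_ring_bracket]
  refine LinearMap.ext fun v => Prod.ext ?_ ?_
  · simp only [affineOp_apply, LinearMap.sub_apply, Module.End.mul_apply, Prod.fst_sub, lie_lie,
      lie_add, lie_smul, zero_smul, smul_add, add_zero, ← lie_skew b a', smul_neg]
    abel
  · simp [affineOp_apply]

/-- The vector `(0, 1)` recovers `b`, whereas `a` is seen only through `ad a`, hence modulo the
centre. -/
theorem affineOp_inj {a b a' b' : L} (h : affineOp a b = affineOp a' b') : b = b' := by
  have h1 := congrArg (fun T : Module.End ℝ (L × ℝ) => (T (0, 1)).1) h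
  simpa [affineOp_apply] using h1

/-- The filtration of `L × ℝ` by the whole space and the lower central series of `L`. -/
def affineFiltration (L : Type*) [LieRing L] [LieAlgebra ℝ L] : ℕ → Submodule ℝ (L × ℝ)
  | 0 => ⊤
  | i + 1 => ((LieModule.lowerCentralSeries ℝ L L i : LieSubmodule ℝ L L) : Submodule ℝ L).prod ⊥

theorem affineFiltration_antitone : Antitone (affineFiltration L) := by
  refine antitone_nat_of_succ_le fun i => ?_
  cases i with
  | zero => exact le_top
  | succ i =>
    exact Submodule.prod_mono
      (LieModule.antitone_lowerCentralSeries ℝ L L (Nat.le_succ i)) le_rfl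

/-- The filtration of the operators on `L × ℝ` induced by the lower central series of `L`. -/
def affineNilFiltration {k : ℕ} (hk : LieModule.lowerCentralSeries ℝ L L k = ⊥) :
    NilFiltration (Module.End ℝ (L × ℝ)) (k + 1) where
  part i :=
    { carrier := {T | ∀ j, ∀ v ∈ affineFiltration L j, T v ∈ affineFiltration L (i + j)}
      add_mem' := fun hS hT j v hv => Submodule.add_mem _ (hS j v hv) (hT j v hv)
      zero_mem' := fun j v _ => Submodule.zero_mem _
      smul_mem' := fun r T hT j v hv => Submodule.smul_mem _ r (hT j v hv) }
  antitone i i' h T hT j v hv :=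
    affineFiltration_antitone (Nat.add_le_add_right h j) (hT j v hv)
  mul_mem {i i' S T} hS hT j v hv := by
    rw [add_assoc]
    exact hS _ _ (hT j v hv)
  eq_zero {T} hT := by
    refine LinearMap.ext fun v => ?_
    -- An operator of degree `k + 1` sends the whole space, in degree `0`, into degree `k + 1`,
    -- which is `lowerCentralSeries k × 0 = 0`.
    have h := hT 0 v (Submodule.mem_top (R := ℝ))
    rw [add_zero, affineFiltration, hk] at h
    exact Prod.ext ((Submodule.mem_bot ℝ).1 h.1) ((Submodule.mem_bot ℝ).1 h.2)

/-- From degree `0` the operator lands in `L × 0`, which is degree `1`. In higher degrees the real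
coordinate is zero, so only `ad a` acts, and it moves one step down the lower central series. -/
theorem affineOp_mem {k : ℕ} (hk : LieModule.lowerCentralSeries ℝ L L k = ⊥) (a b : L) :
    affineOp a b ∈ (affineNilFiltration hk).part 1 := by
  intro j v hv
  rw [add_comm]
  refine ⟨?_, Submodule.zero_mem _⟩
  cases j with
  | zero => exact Submodule.mem_top
  | succ j =>
    have h2 : v.2 = 0 := (Submodule.mem_bot ℝ).1 hv.2
    change ⁅a, v.1⁆ + v.2 • b ∈ LieModule.lowerCentralSeries ℝ L L (j + 1)
    rw [h2, zero_smul, add_zero, LieModule.lowerCentralSeries_succ]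
    exact LieSubmodule.lie_mem_lie (LieSubmodule.mem_top a) hv.1

theorem bchSum_zero_zero (M : ℕ) : bchSum M (0 : L) 0 = 0 :=
  (map_bchSum (0 : L →ₗ⁅ℝ⁆ L) M 0 0).symm

end Affine

/-! ### Differentiable curves in `n_A` -/

namespace LieSuperalgebra

open PowerSeries

attribute [local instance] LieRing.ofAssociativeRing

variable {n : LieSuperalgebra.{u}} {p : ℕ}

theorem hasFDerivAt_lie {E : Type*} [NormedAddCommGroup E] [NormedSpace ℝ E]
    {f g : E → n.Points p} {f' g' : E →L[ℝ] n.Points p} {x : E} (hf : HasFDerivAt f f' x)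
    (hg : HasFDerivAt g g' x) :
    HasFDerivAt (fun y => ⁅f y, g y⁆)
      ((n.pointsBracket p).toContinuousBilinearMap.precompR E (f x) g' +
        (n.pointsBracket p).toContinuousBilinearMap.precompL E f' (g x)) x :=
  (n.pointsBracket p).toContinuousBilinearMap.hasFDerivAt_of_bilinear hf hg

theorem hasDerivAt_lie {f g : ℝ → n.Points p} {f' g' : n.Points p} {t : ℝ}
    (hf : HasDerivAt f f' t) (hg : HasDerivAt g g' t) :
    HasDerivAt (fun s => ⁅f s, g s⁆) (⁅f t, g'⁆ + ⁅f', g t⁆) t := by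
  have h := (hasFDerivAt_lie hf.hasFDerivAt hg.hasFDerivAt).hasDerivAt
  refine h.congr_deriv ?_
  simp
  rfl

variable (n p) in
/-- The space of differentiable curves in `n_A`. -/
def curves : Submodule ℝ (ℝ → n.Points p) where
  carrier := {f | Differentiable ℝ f}
  add_mem' hf hg := hf.add hg
  zero_mem' := differentiable_const 0
  smul_mem' r _ hf := hf.const_smul r

noncomputable instance : LieRing (curves n p) where
  bracket f g := ⟨fun t => ⁅f.1 t, g.1 t⁆, fun t =>
    (hasDerivAt_lie (f.2 t).hasDerivAt (g.2 t).hasDerivAt).differentiableAt⟩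
  add_lie _ _ _ := Subtype.ext (funext fun _ => add_lie _ _ _)
  lie_add _ _ _ := Subtype.ext (funext fun _ => lie_add _ _ _)
  lie_self _ := Subtype.ext (funext fun _ => lie_self _)
  leibniz_lie _ _ _ := Subtype.ext (funext fun _ => leibniz_lie _ _ _)

noncomputable instance : LieAlgebra ℝ (curves n p) where
  lie_smul r f g := Subtype.ext (funext fun t => lie_smul r (f.1 t) (g.1 t))

/-- The value of a curve at a point. -/
def evalCurve (t : ℝ) : curves n p →ₗ⁅ℝ⁆ n.Points p where
  toFun f := f.1 t
  map_add' _ _ := rfl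
  map_smul' _ _ := rfl
  map_lie' := rfl

/-- The affine operator given by the value and the derivative of a curve at a point. -/
noncomputable def affineCurve (t : ℝ) : curves n p →ₗ⁅ℝ⁆ Module.End ℝ (n.Points p × ℝ) where
  toFun f := affineOp (f.1 t) (deriv f.1 t)
  map_add' f g := by
    rw [← affineOp_add, ← deriv_add (f.2 t) (g.2 t)]
    rfl
  map_smul' r f := by
    rw [RingHom.id_apply, ← affineOp_smul, ← deriv_const_smul r (f.2 t)]
    rfl
  map_lie' {f g} := by
    change _ = ⁅affineOp (f.1 t) (deriv f.1 t), affineOp (g.1 t) (deriv g.1 t)⁆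
    rw [← affineOp_lie, ← (hasDerivAt_lie (f.2 t).hasDerivAt (g.2 t).hasDerivAt).deriv]
    rfl

variable {k M : ℕ}

/-- The exponential is injective on nilpotent operators, so the affine operators agree, and with
them the velocities at all times; equal initial values then give equal curves. -/
theorem curves_ext (hk : LieModule.lowerCentralSeries ℝ (n.Points p) (n.Points p) k = ⊥)
    (hM : k + 2 ≤ M) {f g : curves n p} (h0 : evalCurve 0 f = evalCurve 0 g)
    (h : ∀ t, evalTrunc M (exp ℝ) (affineCurve t f) = evalTrunc M (exp ℝ) (affineCurve t g)) :
    f = g := by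
  have hpow : ∀ (t : ℝ) (f : curves n p), affineCurve t f ^ M = 0 := fun t f =>
    pow_eq_zero_of_le hM ((affineNilFiltration hk).pow_eq_zero (affineOp_mem hk _ _))
  have hd : ∀ t, deriv f.1 t = deriv g.1 t := fun t =>
    affineOp_inj (evalTrunc_exp_injective (hpow t f) (hpow t g) (h t))
  have hfg : ∀ t, deriv (f.1 - g.1) t = 0 := fun t => by
    rw [deriv_sub (f.2 t) (g.2 t), hd, sub_self]
  refine Subtype.ext (funext fun t => ?_)
  have h1 := is_const_of_deriv_eq_zero (f.2.sub g.2) hfg t 0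
  have h2 : f.1 0 - g.1 0 = 0 := sub_eq_zero.2 h0
  exact sub_eq_zero.1 (h1.trans h2)

/-- `affineCurve t` is a Lie homomorphism into a nilpotent associative algebra. Its filtration
vanishes in degree `k + 1`, whence the bound `2 * (k + 2)`. -/
theorem exp_affineCurve_bchSum
    (hk : LieModule.lowerCentralSeries ℝ (n.Points p) (n.Points p) k = ⊥)
    (hM : 2 * (k + 2) ≤ M) (t : ℝ) (f g : curves n p) :
    evalTrunc M (exp ℝ) (affineCurve t (bchSum M f g)) =
      evalTrunc M (exp ℝ) (affineCurve t f) * evalTrunc M (exp ℝ) (affineCurve t g) := by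
  rw [map_bchSum]
  exact (affineNilFiltration hk).exp_bchSum (affineOp_mem hk _ _) (affineOp_mem hk _ _) hM

/-- The curve `t ↦ t X`. -/
noncomputable def line (X : n.Points p) : curves n p := ⟨fun t => t • X, differentiable_id.smul_const X⟩

theorem evalCurve_zero_line (X : n.Points p) : evalCurve 0 (line X) = 0 := zero_smul ℝ X

theorem evalCurve_one_line (X : n.Points p) : evalCurve 1 (line X) = X := one_smul ℝ X

theorem evalTrunc_exp_affineCurve_zero (hM : 0 < M) (t : ℝ) :
    evalTrunc M (exp ℝ) (affineCurve t (0 : curves n p)) = 1 := by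
  rw [map_zero, evalTrunc_zero_right hM.ne', constantCoeff_exp, map_one]

/-- For the curves `t ↦ t X`, `t Y`, `t Z` both bracketings start at `0` and have the same triple
product of exponentials at every time, so they coincide; `t = 1` is the claim. The unit and inverse
laws follow the same pattern. -/
theorem bchSum_assoc (hk : LieModule.lowerCentralSeries ℝ (n.Points p) (n.Points p) k = ⊥)
    (hM : 2 * (k + 2) ≤ M) (X Y Z : n.Points p) :
    bchSum M (bchSum M X Y) Z = bchSum M X (bchSum M Y Z) := by
  have h : bchSum M (bchSum M (line X) (line Y)) (line Z) =
      bchSum M (line X) (bchSum M (line Y) (line Z)) := by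
    refine curves_ext hk (show k + 2 ≤ M by omega) ?_ fun t => ?_
    · simp only [map_bchSum, evalCurve_zero_line, bchSum_zero_zero]
    · simp only [exp_affineCurve_bchSum hk hM, mul_assoc]
  simpa only [map_bchSum, evalCurve_one_line] using congrArg (evalCurve 1) h

theorem bchSum_zero_right (hk : LieModule.lowerCentralSeries ℝ (n.Points p) (n.Points p) k = ⊥)
    (hM : 2 * (k + 2) ≤ M) (X : n.Points p) : bchSum M X 0 = X := by
  have h : bchSum M (line X) 0 = line X := by
    refine curves_ext hk (show k + 2 ≤ M by omega) ?_ fun t => ?_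
    · simp only [map_bchSum, evalCurve_zero_line, map_zero, bchSum_zero_zero]
    · rw [exp_affineCurve_bchSum hk hM, evalTrunc_exp_affineCurve_zero (by omega), mul_one]
  simpa only [map_bchSum, evalCurve_one_line, map_zero] using congrArg (evalCurve 1) h

theorem bchSum_zero_left (hk : LieModule.lowerCentralSeries ℝ (n.Points p) (n.Points p) k = ⊥)
    (hM : 2 * (k + 2) ≤ M) (X : n.Points p) : bchSum M 0 X = X := by
  have h : bchSum M 0 (line X) = line X := by
    refine curves_ext hk (show k + 2 ≤ M by omega) ?_ fun t => ?_
    · simp only [map_bchSum, evalCurve_zero_line, map_zero, bchSum_zero_zero]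
    · rw [exp_affineCurve_bchSum hk hM, evalTrunc_exp_affineCurve_zero (by omega), one_mul]
  simpa only [map_bchSum, evalCurve_one_line, map_zero] using congrArg (evalCurve 1) h

theorem bchSum_neg_right (hk : LieModule.lowerCentralSeries ℝ (n.Points p) (n.Points p) k = ⊥)
    (hM : 2 * (k + 2) ≤ M) (X : n.Points p) : bchSum M X (-X) = 0 := by
  have h : bchSum M (line X) (-line X) = 0 := by
    refine curves_ext hk (show k + 2 ≤ M by omega) ?_ fun t => ?_
    · simp only [map_bchSum, evalCurve_zero_line, map_zero, map_neg, neg_zero, bchSum_zero_zero]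
    · rw [exp_affineCurve_bchSum hk hM, evalTrunc_exp_affineCurve_zero (by omega), map_neg]
      exact evalTrunc_exp_mul_exp_neg (pow_eq_zero_of_le (by omega)
        ((affineNilFiltration hk).pow_eq_zero (affineOp_mem hk _ _)))
  simpa only [map_bchSum, evalCurve_one_line, map_zero, map_neg] using congrArg (evalCurve 1) h

theorem bchSum_neg_left (hk : LieModule.lowerCentralSeries ℝ (n.Points p) (n.Points p) k = ⊥)
    (hM : 2 * (k + 2) ≤ M) (X : n.Points p) : bchSum M (-X) X = 0 := by
  simpa using bchSum_neg_right hk hM (-X)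

end LieSuperalgebra

/-! ### The supergroup of a nilpotent Lie superalgebra -/

namespace LieSuperalgebra

variable {n : LieSuperalgebra.{u}} {p q k : ℕ}

theorem lie_val (x y : n.Points p) : (⁅x, y⁆ : n.Points p).1 = n.tensorBracket p x.1 y.1 := rfl

/-- `tensorBracket` multiplies coefficients and brackets vectors without regard to parity, so pure
tensors suffice and no signs enter. -/
theorem foldr_lie_mem_span (l : List (n.Points p)) (y : n.Points p) :
    (l.foldr (fun a b => ⁅a, b⁆) y).1 ∈ Submodule.span ℝ {t : Grassmann p ⊗[ℝ] n.carrier |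
      ∃ (a : Grassmann p) (l' : List n.carrier) (y' : n.carrier), l'.length = l.length ∧
        a ⊗ₜ[ℝ] l'.foldr (fun x z => n.bracket x z) y' = t} := by
  induction l with
  | nil =>
    change y.1 ∈ _
    generalize y.1 = t
    induction t using TensorProduct.induction_on with
    | zero => exact Submodule.zero_mem _
    | add s t hs ht => exact Submodule.add_mem _ hs ht
    | tmul a x => exact Submodule.subset_span ⟨a, [], x, rfl, rfl⟩
  | cons x l ih =>
    rw [List.foldr_cons, lie_val]
    generalize (l.foldr (fun a b => ⁅a, b⁆) y).1 = z at ih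
    induction ih using Submodule.span_induction with
    | zero => rw [map_zero]; exact Submodule.zero_mem _
    | add s t _ _ hs ht => rw [map_add]; exact Submodule.add_mem _ hs ht
    | smul r t _ ht => rw [map_smul]; exact Submodule.smul_mem _ r ht
    | mem z hz =>
      obtain ⟨b, l', y', hl, rfl⟩ := hz
      generalize x.1 = t
      induction t using TensorProduct.induction_on with
      | zero => rw [map_zero, LinearMap.zero_apply]; exact Submodule.zero_mem _
      | add s t hs ht => rw [map_add, LinearMap.add_apply]; exact Submodule.add_mem _ hs ht
      | tmul a x =>
        exact Submodule.subset_span ⟨b * a, x :: l', y', by simp [hl], rfl⟩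

theorem IsStepNilpotent.foldr_lie_eq_zero (hk : n.IsStepNilpotent k) (l : List (n.Points p))
    (y : n.Points p) (hl : k ≤ l.length) : l.foldr (fun a b => ⁅a, b⁆) y = 0 := by
  -- Only the outermost `k` brackets are needed; the inner ones are absorbed into the last argument.
  rw [← List.take_append_drop k l, List.foldr_append]
  generalize (l.drop k).foldr (fun a b => ⁅a, b⁆) y = z
  apply Subtype.ext
  have h := foldr_lie_mem_span (l.take k) z
  rw [Submodule.span_eq_bot.2] at h
  · exact (Submodule.mem_bot ℝ).1 h
  · rintro _ ⟨a, l', y', hl', rfl⟩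
    rw [hk l' y' (by rw [hl', List.length_take, min_eq_left hl]), TensorProduct.tmul_zero]

theorem IsStepNilpotent.lowerCentralSeries_eq_bot (hk : n.IsStepNilpotent k) (p : ℕ) :
    LieModule.lowerCentralSeries ℝ (n.Points p) (n.Points p) k = ⊥ :=
  lowerCentralSeries_eq_bot_of_foldr fun l y hl => hk.foldr_lie_eq_zero l y hl.ge

/-- A word of length `d` amounts to `d - 1 ≥ k` nested brackets applied to its last letter. -/
theorem IsStepNilpotent.bchTerm_eq_zero (hk : n.IsStepNilpotent k) {d : ℕ} (hd : k < d)
    (X Y : n.Points p) : bchTerm d X Y = 0 := by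
  refine _root_.bchTerm_eq_zero fun l hl _ => ?_
  have hne : l ≠ [] := by
    rintro rfl
    simp at hl
    omega
  rw [← List.dropLast_append_getLast hne, nestedLie_eq_foldr]
  exact hk.foldr_lie_eq_zero _ _ (by rw [List.length_dropLast]; omega)

theorem IsStepNilpotent.bch_eq_bchSum (hk : n.IsStepNilpotent k) {M : ℕ} (hM : k < M)
    (X Y : n.Points p) : bch X Y = bchSum M X Y := by
  refine finsum_eq_sum_of_support_subset _ fun d hd => ?_
  rw [Finset.coe_range, Set.mem_Iio]
  by_contra h
  exact hd (hk.bchTerm_eq_zero (by omega) X Y)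

variable (n) in
/-- The homomorphism of Lie algebras `n_A → n_B` induced by `f : A → B`. -/
noncomputable def mapLie (f : GrassmannHom p q) : n.Points p →ₗ⁅ℝ⁆ n.Points q :=
  { n.toSuperVect.map f with
    map_lie' := fun {x y} => by
      apply Subtype.ext
      change LinearMap.rTensor n.carrier f.toAlgHom.toLinearMap (n.tensorBracket p x.1 y.1) =
        n.tensorBracket q (LinearMap.rTensor n.carrier f.toAlgHom.toLinearMap x.1)
          (LinearMap.rTensor n.carrier f.toAlgHom.toLinearMap y.1)
      generalize x.1 = s
      generalize y.1 = t
      induction s using TensorProduct.induction_on with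
      | zero => simp only [map_zero, LinearMap.zero_apply]
      | add s s' hs hs' => simp only [map_add, LinearMap.add_apply, hs, hs']
      | tmul a x =>
        induction t using TensorProduct.induction_on with
        | zero => simp only [map_zero]
        | add s s' hs hs' => simp only [map_add, hs, hs']
        | tmul b y =>
          change f.toAlgHom (b * a) ⊗ₜ[ℝ] n.bracket x y =
            (f.toAlgHom b * f.toAlgHom a) ⊗ₜ[ℝ] n.bracket x y
          rw [map_mul] }

/-! ### `A₀`-smoothness of iterated brackets -/

section Smooth

variable {V W : SuperVect.{u}}

theorem isEvenSmooth_zero : SuperVect.IsEvenSmooth (fun _ : V.Points p => (0 : W.Points p)) :=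
  SuperVect.IsEvenSmooth.of_linear 0

theorem isEvenSmooth_sum {ι : Type*} (s : Finset ι) {f : ι → V.Points p → W.Points p}
    (hf : ∀ i ∈ s, SuperVect.IsEvenSmooth (f i)) :
    SuperVect.IsEvenSmooth (fun x => ∑ i ∈ s, f i x) := by
  classical
  induction s using Finset.induction_on with
  | empty => exact isEvenSmooth_zero
  | insert i s hi ih =>
    have h := (hf i (by simp)).add (ih fun j hj => hf j (by simp [hj]))
    convert h using 1
    funext x
    rw [Finset.sum_insert hi]
    rfl

theorem isEvenSmooth_smul (r : ℝ) {f : V.Points p → W.Points p}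
    (hf : SuperVect.IsEvenSmooth f) : SuperVect.IsEvenSmooth (fun x => r • f x) :=
  SuperVect.IsEvenSmooth.comp (φ := f)
    (SuperVect.IsEvenSmooth.of_linear (V := W)
      (algebraMap ℝ (Grassmann.evenPart p) r • (LinearMap.id : W.Points p →ₗ[_] W.Points p))) hf
    |> fun h => by
      convert h using 1
      funext x
      exact (algebraMap_smul (Grassmann.evenPart p) r (f x)).symm

/-- The bracket is bilinear over `A₀`, so the product rule expresses the derivative through
`A₀`-linear maps. -/
theorem isEvenSmooth_lie {f g : V.Points p → n.Points p} (hf : SuperVect.IsEvenSmooth f)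
    (hg : SuperVect.IsEvenSmooth g) : SuperVect.IsEvenSmooth (fun x => ⁅f x, g x⁆) := by
  refine ⟨?_, fun x c v => ?_⟩
  · exact ((n.pointsBracket p).toContinuousBilinearMap.contDiff.comp hf.1).clm_apply hg.1
  · have h := hasFDerivAt_lie (hf.1.differentiable (by simp) x).hasFDerivAt
      (hg.1.differentiable (by simp) x).hasFDerivAt
    rw [h.fderiv]
    change ⁅f x, fderiv ℝ g x (c • v)⁆ + ⁅fderiv ℝ f x (c • v), g x⁆ =
      c • (⁅f x, fderiv ℝ g x v⁆ + ⁅fderiv ℝ f x v, g x⁆)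
    rw [hf.2, hg.2, lie_smul, smul_lie, smul_add]

theorem isEvenSmooth_nestedLie (l : List (V.Points p → n.Points p))
    (hl : ∀ f ∈ l, SuperVect.IsEvenSmooth f) :
    SuperVect.IsEvenSmooth (fun x => nestedLie (l.map fun f => f x)) := by
  induction l with
  | nil => exact isEvenSmooth_zero
  | cons f l ih =>
    by_cases h : l = []
    · subst h
      exact hl f (by simp)
    · have h' := isEvenSmooth_lie (hl f (by simp)) (ih fun g hg => hl g (by simp [hg]))
      convert h' using 1
      funext x
      rw [List.map_cons, nestedLie_cons _ (by simpa using h)]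

theorem isEvenSmooth_bchSum (M : ℕ) {f g : V.Points p → n.Points p}
    (hf : SuperVect.IsEvenSmooth f) (hg : SuperVect.IsEvenSmooth g) :
    SuperVect.IsEvenSmooth (fun x => bchSum M (f x) (g x)) := by
  refine isEvenSmooth_sum _ fun d _ => isEvenSmooth_sum _ fun k _ => isEvenSmooth_sum _ fun e _ =>
    isEvenSmooth_smul _ ?_
  -- The word is formed in the maps `f` and `g` themselves; evaluating it letter by letter at `x`
  -- gives the word in `f x` and `g x`.
  have h := isEvenSmooth_nestedLie (bchWord f g e) fun φ hφ => by
    rcases mem_bchWord hφ with rfl | rfl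
    exacts [hf, hg]
  convert h using 1
  funext x
  rw [map_bchWord]

end Smooth

variable (n) in
/-- The multiplication `(X, Y) ↦ Z(X, Y)`, the series being truncated at degree `M`. -/
noncomputable def bchMul (M : ℕ) :
    n.toSuperVect ⊗ n.toSuperVect ⟶ n.toSuperVect :=
  show SuperVect.Hom (n.toSuperVect.prod n.toSuperVect) n.toSuperVect from
  { app := fun p t => bchSum M
      (SuperVect.app (SuperVect.prodFst n.toSuperVect n.toSuperVect) p t : n.Points p)
      (SuperVect.app (SuperVect.prodSnd n.toSuperVect n.toSuperVect) p t : n.Points p)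
    natural := fun f t => by
      rw [SuperVect.app_map, SuperVect.app_map]
      exact (map_bchSum (n.mapLie f) M _ _).symm
    smooth := fun p => isEvenSmooth_bchSum M (SuperVect.Hom.smooth _ p) (SuperVect.Hom.smooth _ p) }

theorem bchMul_app (M p : ℕ) (X Y : n.Points p) :
    SuperVect.app (n.bchMul M) p (SuperVect.pair X Y) = bchSum M X Y := by
  change bchSum M (SuperVect.app (SuperVect.prodFst n.toSuperVect n.toSuperVect) p
    (SuperVect.pair X Y) : n.Points p) (SuperVect.app (SuperVect.prodSnd _ _) p _) = _
  rw [SuperVect.prodFst_pair, SuperVect.prodSnd_pair]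

variable (n) in
/-- The inversion `X ↦ -X`. -/
noncomputable def negHom : n.toSuperVect ⟶ n.toSuperVect :=
  SuperVect.ofLinear (-LinearMap.id) fun _ _ hx => Submodule.neg_mem _ hx

theorem negHom_app (p : ℕ) (X : n.Points p) : SuperVect.app n.negHom p X = -X := by
  apply Subtype.ext
  change (-LinearMap.id : n.carrier →ₗ[ℝ] n.carrier).baseChange (Grassmann p) X.1 = -X.1
  rw [LinearMap.baseChange_neg, LinearMap.baseChange_id]
  rfl

variable (n) in
/-- The unit `0`. -/
noncomputable def zeroHom : 𝟙_ SuperVect.{u} ⟶ n.toSuperVect :=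
  SuperVect.ofLinear (V := SuperVect.point) 0 fun _ _ _ => Submodule.zero_mem _

theorem zeroHom_app (p : ℕ) (e : (𝟙_ SuperVect.{u}).Points p) :
    SuperVect.app n.zeroHom p e = 0 := by
  have h : e = (0 : SuperVect.point.{u}.Points p) := SuperVect.point_eq_zero e
  rw [h]
  exact map_zero (SuperVect.linearApp (V := SuperVect.point.{u}) (W := n.toSuperVect) 0 _ p)

end LieSuperalgebra

/-! ### Group axioms, checked on points -/

namespace LieSuperalgebra

variable {n : LieSuperalgebra.{u}} {k M : ℕ}

open CartesianMonoidalCategory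

/-- Once the structural morphisms of an axiom are written as pairings, this turns the axiom into an
identity for `bchSum`. -/
theorem lift_bchMul_app {U : SuperVect.{u}} (φ ψ : U ⟶ n.toSuperVect) (p : ℕ) (x : U.Points p) :
    SuperVect.app (lift φ ψ ≫ n.bchMul M) p x =
      bchSum M (SuperVect.app φ p x : n.Points p) (SuperVect.app ψ p x) :=
  bchMul_app M p _ _

/-- The supergroup on the supermanifold of a nilpotent Lie superalgebra. -/
noncomputable abbrev bchGrpObj (hk : n.IsStepNilpotent k) (hM : 2 * (k + 2) ≤ M) :
    GrpObj n.toSuperVect where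
  one := n.zeroHom
  mul := n.bchMul M
  inv := n.negHom
  one_mul := by
    refine SuperVect.hom_ext fun p t => ?_
    have h : n.zeroHom ▷ n.toSuperVect = lift (fst _ _ ≫ n.zeroHom) (snd _ _) := by
      ext <;> simp
    rw [h, lift_bchMul_app, SuperVect.comp_app, zeroHom_app,
      bchSum_zero_left (hk.lowerCentralSeries_eq_bot p) hM, leftUnitor_hom]
  mul_one := by
    refine SuperVect.hom_ext fun p t => ?_
    have h : n.toSuperVect ◁ n.zeroHom = lift (fst _ _) (snd _ _ ≫ n.zeroHom) := by
      ext <;> simp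
    rw [h, lift_bchMul_app, SuperVect.comp_app, zeroHom_app,
      bchSum_zero_right (hk.lowerCentralSeries_eq_bot p) hM, rightUnitor_hom]
  mul_assoc := by
    refine SuperVect.hom_ext fun p t => ?_
    have h1 : n.bchMul M ▷ n.toSuperVect =
        lift (lift (fst _ _ ≫ fst _ _) (fst _ _ ≫ snd _ _) ≫ n.bchMul M) (snd _ _) := by
      ext
      · rw [whiskerRight_fst, lift_fst, ← comp_lift, lift_fst_snd, Category.comp_id]
      · rw [whiskerRight_snd, lift_snd]
    have h2 : (α_ n.toSuperVect n.toSuperVect n.toSuperVect).hom ≫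
        n.toSuperVect ◁ n.bchMul M =
        lift (fst _ _ ≫ fst _ _) (lift (fst _ _ ≫ snd _ _) (snd _ _) ≫ n.bchMul M) := by
      ext
      · simp
      · rw [Category.assoc, whiskerLeft_snd, lift_snd, ← Category.assoc]
        congr 1
        ext <;> simp
    rw [← Category.assoc, h2, h1, lift_bchMul_app, lift_bchMul_app, lift_bchMul_app,
      lift_bchMul_app, bchSum_assoc (hk.lowerCentralSeries_eq_bot p) hM]
  left_inv := by
    refine SuperVect.hom_ext fun p t => ?_
    rw [lift_bchMul_app, SuperVect.comp_app, zeroHom_app, negHom_app, SuperVect.id_app,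
      bchSum_neg_left (hk.lowerCentralSeries_eq_bot p) hM]
  right_inv := by
    refine SuperVect.hom_ext fun p t => ?_
    rw [lift_bchMul_app, SuperVect.comp_app, zeroHom_app, negHom_app, SuperVect.id_app,
      bchSum_neg_right (hk.lowerCentralSeries_eq_bot p) hM]

end LieSuperalgebra

theorem mainTheorem4 (n : LieSuperalgebra.{u}) (hn : n.IsNilpotent) :
    (∀ p : ℕ, LieRing.IsNilpotent (n.Points p)) ∧
    (∀ k : ℕ, n.IsStepNilpotent k → ∀ (p d : ℕ), k < d → ∀ X Y : n.Points p,
      bchTerm d X Y = 0) ∧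
    ∃ N : GrpObj n.toSuperVect, ∀ p : ℕ,
      (∀ X Y : n.Points p, SuperVect.app N.mul p (SuperVect.pair X Y) = bch X Y) ∧
      (∀ X : n.Points p, SuperVect.app N.inv p X = -X) ∧
      (∀ e : (𝟙_ SuperVect.{u}).Points p, SuperVect.app N.one p e = 0) := by
  obtain ⟨k, hk⟩ := hn
  refine ⟨fun p => LieModule.IsNilpotent.mk _ (hk.lowerCentralSeries_eq_bot p),
    fun k hk p d hd X Y => hk.bchTerm_eq_zero hd X Y,
    -- The truncation degree is `M = 2 * (k + 2)`, the same for every Grassmann algebra; it exceeds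
    -- `k`, so the truncated series is the full one.
    LieSuperalgebra.bchGrpObj hk le_rfl, fun p => ⟨fun X Y => ?_, fun X => ?_, fun e => ?_⟩⟩
  · rw [hk.bch_eq_bchSum (by omega : k < 2 * (k + 2))]
    exact LieSuperalgebra.bchMul_app _ p X Y
  · exact LieSuperalgebra.negHom_app p X
  · exact LieSuperalgebra.zeroHom_app p e
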